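/- Let $\lambda>0$ and $\alpha>0$. Consider the following multiserver model. At time $0$ there are $N_0$ jobs in the system, where $N_0$ is an arbitrary $\mathbb{N}$-valued random variable (for instance $N_0=0$); further jobs arrive according to a Poisson process of rate $\lambda$; the sizes of all jobs are i.i.d. exponential with mean one; and $N_0$, the arrival process and the job sizes are independent. Servers have unit speed, each server processes at most one job at a time, and each job is processed by at most one server at a time; a job leaves the system as soon as the time it has spent in service reaches its size. A \emph{policy} chooses at each time $t\ge 0$ which of the $n(t)$ jobs in the system are served; the number $s(t)\in\{0,1,\dots,n(t)\}$ of jobs in service is the number of active servers, and $t\mapsto s(t)$ is required to be piecewise constant and right-continuous. (Policies may use any information, so every online policy is included.) Let $$\mathrm{SC}(t)=\sum_{0<u\le t}\bigl(s(u)-s(u^-)\bigr)^2$$ be the total quadratic switching cost over $[0,t]$. A policy has \emph{cost} $C\in\mathbb{R}$ if, almost surely, $$\lim_{t\to\infty}\left[\frac1t\int_0^t n(u)\,du+\alpha\,\frac{\mathrm{SC}(t)}{t}\right]=C .$$ Let $\mathsf{ALG}_1$ be the policy that uses $\mu_i=i$ servers whenever there are $i$ jobs in the system, i.e. $s(t)=n(t)$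 for all $t\ge0$. Then: 1. $\mathsf{ALG}_1$ is a well-defined policy, and the unique stationary distribution of the number of jobs under it is Poisson($\lambda$): $n(t)$ has the same law as $N_0$ for every $t\ge 0$ if and only if $N_0\sim\mathrm{Poisson}(\lambda)$. 2. Under $\mathsf{ALG}_1$, almost surely $\frac1t\int_0^t n(u)\,du\to\lambda$ and $\mathrm{SC}(t)/t\to 2\lambda$; hence $\mathsf{ALG}_1$ has cost $C_{\mathsf{ALG}_1}=\lambda(1+2\alpha)$. 3. Under every policy, almost surely $\liminf_{t\to\infty}\frac1t\int_0^t n(u)\,du\ge\lambda$. 4. $\mathsf{ALG}_1$ is $(1+2\alpha)$-competitive: $C_{\mathsf{ALG}_1}\le(1+2\alpha)\,C$ for every policy that has a cost $C$. -/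

import Mathlib

open MeasureTheory ProbabilityTheory Filter Set
open scoped Topology NNReal

namespace Multiserver

/-- A sample path of the input: job `j : ℕ` arrives at time `arrival j` and needs `size j` units of
work from a unit-speed server. -/
structure JobStream where
  arrival : ℕ → ℝ
  size : ℕ → ℝ

/-- A sample path of a schedule: `x t` is the set of jobs that are in service at time `t ≥ 0`,
each of them on its own unit-speed server. -/
abbrev Schedule := ℝ → Set ℕ

/-- Work done on job `j` during `[0, t]`: the total time in `[0, t]` during which it is served. -/
noncomputable def attained (x : Schedule) (j : ℕ) (t : ℝ) : ℝ :=
  volume.real {u : ℝ | u ∈ Icc 0 t ∧ j ∈ x u}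

/-- The jobs in the system at time `t`: arrived and not yet completed. -/
def present (J : JobStream) (x : Schedule) (t : ℝ) : Set ℕ :=
  {j | J.arrival j ≤ t ∧ attained x j t < J.size j}

/-- `n(t)`, the number of jobs in the system at time `t`. -/
noncomputable def numJobs (J : JobStream) (x : Schedule) (t : ℝ) : ℕ :=
  (present J x t).ncard

/-- `s(t)`, the number of active servers, i.e. the aggregate service rate at time `t`. -/
noncomputable def numServers (x : Schedule) (t : ℝ) : ℕ :=
  (x t).ncard

/-- `s` is piecewise constant and right-continuous on `[0, ∞)`: on each `[0, T]` there are
finitely many breakpoints such that `s u = s v` if no breakpoint lies in `(u, v]`. -/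
def IsStepFunction (s : ℝ → ℕ) : Prop :=
  ∀ T : ℝ, ∃ F : Finset ℝ, ∀ u v : ℝ, 0 ≤ u → u ≤ v → v ≤ T →
    (∀ c ∈ F, ¬ (u < c ∧ c ≤ v)) → s u = s v

/-- Feasibility in the multiserver model: only jobs in the system are served
(so `s(t) ∈ {0, …, n(t)}`), and `s` is piecewise constant. -/
structure IsFeasible (J : JobStream) (x : Schedule) : Prop where
  measurableSet_served : ∀ j, MeasurableSet {t : ℝ | 0 ≤ t ∧ j ∈ x t}
  served_subset : ∀ t, 0 ≤ t → x t ⊆ present J x t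
  isStepFunction : IsStepFunction (numServers x)

/-- Total quadratic switching cost over `[0, t]`: the sum of the squared jumps of `s`
(finitely many for a step function). -/
noncomputable def switchingCost (s : ℝ → ℕ) (t : ℝ) : ℝ :=
  ∑ᶠ u ∈ Ioc 0 t, ((s u : ℝ) - Function.leftLim (fun v => (s v : ℝ)) u) ^ 2

/-- `(1/t) ∫₀ᵗ n(u) du`. -/
noncomputable def avgOccupancy (J : JobStream) (x : Schedule) (t : ℝ) : ℝ :=
  (1 / t) * ∫ u in (0 : ℝ)..t, (numJobs J x u : ℝ)

/-- `SC(t) / t`. -/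
noncomputable def switchingRate (x : Schedule) (t : ℝ) : ℝ :=
  switchingCost (numServers x) t / t

/-- Input with `N₀` jobs present at time `0` (these are the jobs `j < N₀`); the later jobs arrive
at the times `T 0`, `T 0 + T 1`, `T 0 + T 1 + T 2`, …; job `j` has size `S j`. -/
noncomputable def jobStream (N₀ : ℕ) (T S : ℕ → ℝ) : JobStream where
  arrival j := if j < N₀ then 0 else ∑ i ∈ Finset.range (j - N₀ + 1), T i
  size := S

section Stochastic

variable {Ω : Type*} [MeasurableSpace Ω]

/-- The primitive random variables: the interarrival times `T i` are i.i.d. exponential with rate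
`lam` (so arrivals form a Poisson process of rate `lam`), the job sizes `S j` are i.i.d.
exponential with mean one, and the initial number of jobs `N₀`, the interarrival times and the
job sizes are independent. -/
structure IsPoissonExpInput (P : Measure Ω) (lam : ℝ≥0) (N₀ : Ω → ℕ) (T S : ℕ → Ω → ℝ) :
    Prop where
  measurable_init : Measurable N₀
  measurable_interarrival : ∀ i, Measurable (T i)
  measurable_size : ∀ j, Measurable (S j)
  law_interarrival : ∀ i, HasLaw (T i) (expMeasure lam) P
  law_size : ∀ j, HasLaw (S j) (expMeasure 1) P
  indep_interarrival : iIndepFun T P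
  indep_size : iIndepFun S P
  indep_interarrival_size : IndepFun (fun ω i => T i ω) (fun ω j => S j ω) P
  indep_init : IndepFun N₀ (fun ω => ((fun i => T i ω), (fun j => S j ω))) P

/-- The random input built from the primitive random variables. -/
noncomputable def input (N₀ : Ω → ℕ) (T S : ℕ → Ω → ℝ) (ω : Ω) : JobStream :=
  jobStream (N₀ ω) (fun i => T i ω) (fun j => S j ω)

/-- A policy: a random schedule that is almost surely feasible. No information constraint is
imposed, so that every online policy (deterministic or randomized) is covered. -/
def IsPolicy (P : Measure Ω) (J : Ω → JobStream) (x : Ω → Schedule) : Prop :=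
  ∀ᵐ ω ∂P, IsFeasible (J ω) (x ω)

/-- The policy operates `μ i` servers whenever there are `i` jobs in the system. -/
def UsesRates (P : Measure Ω) (J : Ω → JobStream) (μ : ℕ → ℕ) (x : Ω → Schedule) : Prop :=
  ∀ᵐ ω ∂P, ∀ t, 0 ≤ t → numServers (x ω) t = μ (numJobs (J ω) (x ω) t)

/-- The constant `C` is the almost sure limit of the time-average cost. -/
def HasCost (P : Measure Ω) (J : Ω → JobStream) (α : ℝ) (x : Ω → Schedule) (C : ℝ) : Prop :=
  ∀ᵐ ω ∂P, Tendsto (fun t => avgOccupancy (J ω) (x ω) t + α * switchingRate (x ω) t)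
    atTop (𝓝 C)

/-- The cost of `x` is at most `ρ` times the cost of any policy that has a cost. -/
def IsCompetitive (P : Measure Ω) (J : Ω → JobStream) (α ρ : ℝ) (x : Ω → Schedule) : Prop :=
  ∃ C, HasCost P J α x C ∧
    ∀ (y : Ω → Schedule) (C' : ℝ), IsPolicy P J y → HasCost P J α y C' → C ≤ ρ * C'

end Stochastic

end Multiserver

/-! ### Pathwise comparison with the schedule that serves every job -/

namespace Multiserver

/-! Since job `j` is served at speed at most one and never before its arrival, it cannot leave
before `arrival j + size j`. Serving everybody attains this bound for all jobs at once, so `active J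
t` is contained in the set of jobs present under any feasible schedule. The lower bound on occupancy
and the competitive ratio both rest on this pathwise domination.

For the averages, fix a path satisfying the strong laws for interarrival times and sizes. The
integral of the number of active jobs is a sum of truncated sizes, and sizes seen up to time `t` are
`o(t)`, so the truncation is negligible and the average is `lam` (`tendsto_avg_active`). Almost
surely no two events after time `0` coincide, so each jump has square one and the switching cost
counts arrivals plus departures, each of rate `lam` (`tendsto_switchingCost_active`). The cost is
therefore `lam * (1 + 2 * α)`, while any policy with a cost pays at least `lam` because switching
costs are nonnegative.

For stationarity, the generating function of the occupancy factors into a thinned initial population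
and an empty-start `M/M/∞` queue (`integral_pow_ncard_active`). The latter factor solves a renewal
equation, which is a contraction in a weighted norm. The Poisson law is seen to be invariant by
multiplying exponentials; conversely, as `t → ∞` the initial population dies out and only the
Poisson generating function remains. -/

/-- The jobs in the system at time `t` when every job is served from its arrival on. -/
def active (J : JobStream) (t : ℝ) : Set ℕ :=
  {j | J.arrival j ≤ t ∧ t < J.arrival j + J.size j}

/-- An input path with nonnegative arrival times, positive sizes and locally finitely many
arrivals. -/
structure IsRegular (J : JobStream) : Prop where
  arrival_nonneg : ∀ j, 0 ≤ J.arrival j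
  size_pos : ∀ j, 0 < J.size j
  finite_arrivals : ∀ t, {j | J.arrival j ≤ t}.Finite

variable {J : JobStream} {x : Schedule}

lemma finite_volume_served (x : Schedule) (j : ℕ) (t : ℝ) :
    volume {u : ℝ | u ∈ Icc 0 t ∧ j ∈ x u} ≠ ⊤ :=
  measure_ne_top_of_subset (fun _ hu => hu.1) (by simp : volume (Icc 0 t) ≠ ⊤)

lemma attained_mono (x : Schedule) (j : ℕ) : Monotone (attained x j) := fun _ t hst =>
  measureReal_mono (fun _ hu => ⟨⟨hu.1.1, hu.1.2.trans hst⟩, hu.2⟩) (finite_volume_served x j t)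

lemma attained_le_of_arrival_le (hx : IsFeasible J x) {j : ℕ} {t : ℝ} (hj : J.arrival j ≤ t) :
    attained x j t ≤ t - J.arrival j := by
  have : attained x j t ≤ volume.real (Icc (J.arrival j) t) :=
    measureReal_mono (fun u hu => ⟨(hx.served_subset u hu.1.1 hu.2).1, hu.1.2⟩) (by simp)
  simpa [Real.volume_real_Icc_of_le hj] using this

/-- Before `arrival j + size j` a unit-speed server has had too little time to finish the job. This
is the source of the lower bound for arbitrary policies. -/
lemma active_subset_present (hx : IsFeasible J x) (t : ℝ) : active J t ⊆ present J x t :=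
  fun j hj => ⟨hj.1, by have := attained_le_of_arrival_le hx hj.1; linarith [hj.2]⟩

lemma finite_present (hJ : IsRegular J) (x : Schedule) (t : ℝ) : (present J x t).Finite :=
  (hJ.finite_arrivals t).subset fun _ hj => hj.1

lemma finite_active (hJ : IsRegular J) (t : ℝ) : (active J t).Finite :=
  (hJ.finite_arrivals t).subset fun _ hj => hj.1

lemma ncard_active_le_numJobs (hJ : IsRegular J) (hx : IsFeasible J x) (t : ℝ) :
    (active J t).ncard ≤ numJobs J x t :=
  ncard_le_ncard (active_subset_present hx t) (finite_present hJ x t)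

/-- A policy is specified only through the number of servers; finiteness and feasibility turn
equality of counts into equality of sets. -/
lemma served_eq_present (hJ : IsRegular J) (hx : IsFeasible J x) {t : ℝ} (ht : 0 ≤ t)
    (h : numServers x t = numJobs J x t) : x t = present J x t :=
  eq_of_subset_of_ncard_le (hx.served_subset t ht) h.ge (finite_present hJ x t)

/-- If all jobs in the system are always served, then each job leaves `size` after its arrival. -/
lemma present_eq_active (hJ : IsRegular J) (hx : IsFeasible J x)
    (h : ∀ t, 0 ≤ t → numServers x t = numJobs J x t) (t : ℝ) :
    present J x t = active J t := by
  refine Subset.antisymm (fun j hj => ⟨hj.1, ?_⟩) (active_subset_present hx t)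
  by_contra! hlt
  -- Attained work is monotone, so a job unfinished at `t` was present, hence served, during all of
  -- `[arrival j, t]`; its attained work then already reaches its size.
  have hsub : Icc (J.arrival j) t ⊆ {u : ℝ | u ∈ Icc 0 t ∧ j ∈ x u} := fun u hu => by
    have hu0 := (hJ.arrival_nonneg j).trans hu.1
    refine ⟨⟨hu0, hu.2⟩, ?_⟩
    rw [served_eq_present hJ hx hu0 (h u hu0)]
    exact ⟨hu.1, (attained_mono x j hu.2).trans_lt hj.2⟩
  have := measureReal_mono hsub (finite_volume_served x j t)
  rw [Real.volume_real_Icc_of_le hj.1] at this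
  have h2 := hj.2
  rw [attained] at h2
  linarith

lemma attained_active (hJ : IsRegular J) (j : ℕ) (t : ℝ) :
    attained (active J) j t = volume.real (Icc (J.arrival j) t ∩ Iio (J.arrival j + J.size j)) := by
  have : {u : ℝ | u ∈ Icc 0 t ∧ j ∈ active J u} =
      Icc (J.arrival j) t ∩ Iio (J.arrival j + J.size j) := by
    ext u
    have := hJ.arrival_nonneg j
    simp only [active, mem_ofPred_eq, mem_Icc, mem_inter_iff, mem_Iio]
    constructor
    · rintro ⟨⟨_, h1⟩, h2, h3⟩; exact ⟨⟨h2, h1⟩, h3⟩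
    · rintro ⟨⟨h2, h1⟩, h3⟩; exact ⟨⟨this.trans h2, h1⟩, h2, h3⟩
  rw [attained, this]

/-- Presence depends on the schedule itself, so this fixed-point identity is what makes the explicit
schedule consistent with its own dynamics. -/
lemma present_active (hJ : IsRegular J) (t : ℝ) : present J (active J) t = active J t := by
  ext j
  refine and_congr_right fun hj => ?_
  rw [attained_active hJ]
  constructor
  · intro h
    by_contra! hlt
    have hsub : Ico (J.arrival j) (J.arrival j + J.size j) ⊆
        Icc (J.arrival j) t ∩ Iio (J.arrival j + J.size j) :=
      fun u hu => ⟨⟨hu.1, hu.2.le.trans hlt⟩, hu.2⟩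
    have := measureReal_mono hsub
      (measure_ne_top_of_subset inter_subset_left (by simp : volume (Icc (J.arrival j) t) ≠ ⊤))
    rw [Real.volume_real_Ico_of_le (by linarith [hJ.size_pos j])] at this
    linarith
  · intro h
    have := measureReal_mono (μ := volume)
      (inter_subset_left : Icc (J.arrival j) t ∩ Iio (J.arrival j + J.size j) ⊆ _) (by simp)
    rw [Real.volume_real_Icc_of_le hj] at this
    linarith

lemma isStepFunction_ncard_active (hJ : IsRegular J) :
    IsStepFunction (fun t => (active J t).ncard) := by
  intro T
  refine ⟨(hJ.finite_arrivals T).toFinset.image J.arrival ∪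
    (hJ.finite_arrivals T).toFinset.image (fun j => J.arrival j + J.size j), ?_⟩
  intro u v _ huv hvT hF
  have key : ∀ j, J.arrival j ≤ v → ¬ (u < J.arrival j) ∧
      (J.arrival j + J.size j ≤ v → J.arrival j + J.size j ≤ u) := fun j hj => by
    have hmem : j ∈ (hJ.finite_arrivals T).toFinset := by simpa using hj.trans hvT
    refine ⟨fun h => hF _ (Finset.mem_union_left _ (Finset.mem_image_of_mem _ hmem)) ⟨h, hj⟩, ?_⟩
    intro h
    by_contra! h'
    exact hF _ (Finset.mem_union_right _
      (Finset.mem_image_of_mem (fun j => J.arrival j + J.size j) hmem)) ⟨h', h⟩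
  change (active J u).ncard = (active J v).ncard
  congr 1
  ext j
  constructor
  · rintro ⟨h1, h2⟩
    refine ⟨h1.trans huv, ?_⟩
    by_contra! h
    linarith [(key j (h1.trans huv)).2 h]
  · rintro ⟨h1, h2⟩
    exact ⟨not_lt.1 (key j h1).1, huv.trans_lt h2⟩

lemma isFeasible_active (hJ : IsRegular J) : IsFeasible J (active J) where
  measurableSet_served j := by
    have : {t : ℝ | 0 ≤ t ∧ j ∈ active J t} =
        Ici 0 ∩ Ico (J.arrival j) (J.arrival j + J.size j) := rfl
    rw [this]
    exact measurableSet_Ici.inter measurableSet_Ico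
  served_subset t _ := (present_active hJ t).ge
  isStepFunction := isStepFunction_ncard_active hJ

lemma numServers_active (hJ : IsRegular J) (t : ℝ) :
    numServers (active J) t = numJobs J (active J) t := by
  rw [numServers, numJobs, present_active hJ]

lemma measurableSet_present (J : JobStream) (x : Schedule) (j : ℕ) :
    MeasurableSet {t | j ∈ present J x t} :=
  measurableSet_Ici.inter ((attained_mono x j).measurable measurableSet_Iio)

lemma ncard_eq_sum_indicator {A : ℝ → Set ℕ} {F : Finset ℕ} {u : ℝ} (h : A u ⊆ F) :
    ((A u).ncard : ℝ) = ∑ j ∈ F, {t | j ∈ A t}.indicator (fun _ => (1 : ℝ)) u := by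
  classical
  have : A u = (F.filter (· ∈ A u) : Finset ℕ) := by
    ext j; simpa using fun hj => h hj
  rw [this, ncard_coe_finset, Finset.card_filter]
  push_cast
  refine Finset.sum_congr rfl fun j _ => ?_
  simp [indicator_apply]

/-- On a bounded interval the count is a finite sum of indicators, each measurable because attained
work is monotone in time. Integrability is needed since integrals are to be compared and a
non-integrable function would have integral `0`. -/
lemma intervalIntegrable_numJobs (hJ : IsRegular J) (x : Schedule) (t : ℝ) :
    IntervalIntegrable (fun u => (numJobs J x u : ℝ)) volume 0 t := by
  obtain ⟨b, h0, hb⟩ : ∃ b, 0 ≤ b ∧ t ≤ b := ⟨max 0 t, le_max_left _ _, le_max_right _ _⟩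
  rw [intervalIntegrable_iff]
  have : IntegrableOn (fun u => ∑ j ∈ (hJ.finite_arrivals b).toFinset,
      {t | j ∈ present J x t}.indicator (fun _ => (1 : ℝ)) u) (uIoc 0 t) := by
    refine integrable_finsetSum _ fun j _ => ?_
    exact (integrableOn_const (by simp)).indicator (measurableSet_present J x j)
  refine this.congr_fun (fun u hu => ?_) measurableSet_uIoc
  have hub : u ≤ b := (Set.mem_uIoc.1 hu).elim (fun h => h.2.trans hb) (fun h => h.2.trans h0)
  refine (ncard_eq_sum_indicator fun j hj => ?_).symm
  simpa using hj.1.trans hub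

lemma integral_ncard_active_le (hJ : IsRegular J) (hx : IsFeasible J x) {t : ℝ} (ht : 0 ≤ t) :
    ∫ u in (0 : ℝ)..t, ((active J u).ncard : ℝ) ≤ ∫ u in (0 : ℝ)..t, (numJobs J x u : ℝ) := by
  refine intervalIntegral.integral_mono_on ht ?_ (intervalIntegrable_numJobs hJ x t) fun u _ => ?_
  · have := intervalIntegrable_numJobs hJ (active J) t
    simpa only [numJobs, present_active hJ] using this
  · exact_mod_cast ncard_active_le_numJobs hJ hx u

lemma switchingCost_nonneg (s : ℝ → ℕ) (t : ℝ) : 0 ≤ switchingCost s t :=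
  finsum_nonneg fun _ => finsum_nonneg fun _ => sq_nonneg _

/-- The integral of the number of active jobs splits over the jobs. -/
lemma integral_ncard_active (hJ : IsRegular J) {t : ℝ} (ht : 0 ≤ t) {F : Finset ℕ}
    (hF : ∀ j, j ∈ F ↔ J.arrival j ≤ t) :
    ∫ u in (0 : ℝ)..t, ((active J u).ncard : ℝ) =
      ∑ j ∈ F, min (J.size j) (t - J.arrival j) := by
  have h1 : ∫ u in (0 : ℝ)..t, ((active J u).ncard : ℝ) = ∫ u in (0 : ℝ)..t,
      ∑ j ∈ F, {t | j ∈ active J t}.indicator (fun _ => (1 : ℝ)) u := by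
    refine intervalIntegral.integral_congr fun u hu => ncard_eq_sum_indicator fun j hj => ?_
    rw [uIcc_of_le ht] at hu
    simpa using (hF j).2 (hj.1.trans hu.2)
  have hm : ∀ j, MeasurableSet {t | j ∈ active J t} := fun j => measurableSet_Ico
  rw [h1, intervalIntegral.integral_finsetSum]
  · refine Finset.sum_congr rfl fun j hj => ?_
    have hjt := (hF j).1 hj
    rw [intervalIntegral.integral_of_le ht, ← integral_Icc_eq_integral_Ioc,
      setIntegral_indicator (hm j), setIntegral_const, smul_eq_mul, mul_one]
    have h0 := hJ.arrival_nonneg j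
    have hs := hJ.size_pos j
    change volume.real (Icc 0 t ∩ Ico (J.arrival j) (J.arrival j + J.size j)) = _
    rcases le_or_gt (J.arrival j + J.size j) t with h | h
    · have : Ico (J.arrival j) (J.arrival j + J.size j) ⊆ Icc 0 t :=
        fun u hu => ⟨h0.trans hu.1, hu.2.le.trans h⟩
      rw [inter_eq_right.2 this, Real.volume_real_Ico_of_le (by linarith), min_eq_left (by linarith)]
      ring
    · have : Icc 0 t ∩ Ico (J.arrival j) (J.arrival j + J.size j) = Icc (J.arrival j) t := by
        ext u
        simp only [mem_inter_iff, mem_Icc, mem_Ico]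
        exact ⟨fun hu => ⟨hu.2.1, hu.1.2⟩, fun hu => ⟨⟨h0.trans hu.1, hu.2⟩, hu.1, hu.2.trans_lt h⟩⟩
      rw [this, Real.volume_real_Icc_of_le hjt, min_eq_right (by linarith)]
  · intro j _
    rw [intervalIntegrable_iff]
    exact (integrableOn_const (by simp)).indicator (hm j)

end Multiserver

/-! ### Long-run averages along a fixed ergodic path -/

namespace Multiserver

variable {J : JobStream} {lam : ℝ}

/-- The number of arrivals in `[0, t]`, including the jobs present at time `0`. -/
noncomputable def arrivalCount (J : JobStream) (t : ℝ) : ℕ :=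
  {j | J.arrival j ≤ t}.ncard

/-- A regular input path with ordered arrivals of long-run rate `lam` and sizes of mean one. -/
structure IsErgodic (J : JobStream) (lam : ℝ) : Prop extends IsRegular J where
  rate_pos : 0 < lam
  monotone_arrival : Monotone J.arrival
  tendsto_arrival : Tendsto (fun n : ℕ => J.arrival n / n) atTop (𝓝 lam⁻¹)
  tendsto_size : Tendsto (fun n : ℕ => (∑ j ∈ Finset.range n, J.size j) / n) atTop (𝓝 1)

/-- Arrivals are ordered, so the jobs arrived by `t` form an initial segment of `ℕ`. -/
lemma lt_arrivalCount_iff (hJ : IsErgodic J lam) (t : ℝ) (j : ℕ) :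
    j < arrivalCount J t ↔ J.arrival j ≤ t := by
  have hlow : ∀ i j, i ≤ j → J.arrival j ≤ t → J.arrival i ≤ t :=
    fun i j hij h => (hJ.monotone_arrival hij).trans h
  have hfin := hJ.finite_arrivals t
  constructor
  · intro h
    by_contra! hj
    have : {j | J.arrival j ≤ t} ⊆ (Finset.range j : Set ℕ) := fun i hi => by
      simp only [Finset.coe_range, mem_Iio]
      by_contra! hle
      exact (hj.trans_le (hJ.monotone_arrival hle)).not_ge hi
    have := ncard_le_ncard this (Finset.finite_toSet _)
    rw [ncard_coe_finset, Finset.card_range] at this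
    exact (this.trans_lt h).false
  · intro h
    have : (Finset.range (j + 1) : Set ℕ) ⊆ {j | J.arrival j ≤ t} := fun i hi =>
      hlow i j (by simpa [Nat.lt_succ_iff] using hi) h
    have := ncard_le_ncard this hfin
    rw [ncard_coe_finset, Finset.card_range] at this
    exact this

lemma arrivalCount_mono (hJ : IsErgodic J lam) : Monotone (arrivalCount J) := fun _ t hst =>
  ncard_le_ncard (fun _ hj => le_trans hj hst) (hJ.finite_arrivals t)

lemma tendsto_arrivalCount (hJ : IsErgodic J lam) : Tendsto (arrivalCount J) atTop atTop :=
  tendsto_atTop.2 fun b => (eventually_ge_atTop (J.arrival b)).mono fun t ht =>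
    ((lt_arrivalCount_iff hJ t b).2 ht).le

/-- If `N > 0` jobs have arrived by `t`, then `arrival (N - 1) ≤ t < arrival N`, which squeezes `t /
N` between two sequences tending to `lam⁻¹`. -/
lemma tendsto_arrivalCount_div (hJ : IsErgodic J lam) :
    Tendsto (fun t => (arrivalCount J t : ℝ) / t) atTop (𝓝 lam) := by
  have hc := tendsto_arrivalCount hJ
  have hinv : Tendsto (fun t => t / (arrivalCount J t : ℝ)) atTop (𝓝 lam⁻¹) := by
    have hup := hJ.tendsto_arrival.comp hc
    have hlo : Tendsto (fun n : ℕ => J.arrival (n - 1) / n) atTop (𝓝 lam⁻¹) := by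
      rw [← tendsto_add_atTop_iff_nat 1]
      have := hJ.tendsto_arrival.mul (tendsto_natCast_div_add_atTop (1 : ℝ))
      rw [mul_one] at this
      refine this.congr' ?_
      filter_upwards [eventually_gt_atTop 0] with n hn
      have : (n : ℝ) ≠ 0 := by positivity
      simp only [Nat.add_sub_cancel]
      push_cast
      field_simp
    refine tendsto_of_tendsto_of_tendsto_of_le_of_le' (hlo.comp hc) hup ?_ ?_
    · filter_upwards [hc.eventually_gt_atTop 0] with t ht
      have := (lt_arrivalCount_iff hJ t (arrivalCount J t - 1)).1 (by lia)
      simp only [Function.comp]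
      gcongr
    · filter_upwards with t
      have := (lt_arrivalCount_iff hJ t (arrivalCount J t)).not.1 (lt_irrefl _)
      simp only [Function.comp]
      gcongr
      exact (not_le.1 this).le
  have := hinv.inv₀ (inv_ne_zero hJ.rate_pos.ne')
  simpa using this

/-- A single term is the difference of consecutive partial sums, whose averages have the same limit.
-/
lemma tendsto_size_div (hJ : IsErgodic J lam) :
    Tendsto (fun n : ℕ => J.size n / n) atTop (𝓝 0) := by
  have h1 : Tendsto (fun n : ℕ => (∑ j ∈ Finset.range (n + 1), J.size j) / ((n + 1 : ℕ) : ℝ))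
      atTop (𝓝 1) := (tendsto_add_atTop_iff_nat 1).2 hJ.tendsto_size
  have h2 : Tendsto (fun n : ℕ => ((n : ℝ) + 1) / n) atTop (𝓝 1) := by
    have := (tendsto_natCast_div_add_atTop (1 : ℝ)).inv₀ one_ne_zero
    simpa using this
  have := (h1.mul h2).sub hJ.tendsto_size
  rw [mul_one, sub_self] at this
  refine this.congr' ?_
  filter_upwards [eventually_gt_atTop 0] with n hn
  have : (n : ℝ) ≠ 0 := by positivity
  rw [Finset.sum_range_succ]
  push_cast
  field_simp
  ring

lemma eventually_size_le (hJ : IsErgodic J lam) {ε : ℝ} (hε : 0 < ε) :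
    ∀ᶠ t in atTop, ∀ j < arrivalCount J t, J.size j ≤ ε * t := by
  have hl := hJ.rate_pos
  -- Eventually at most `2 * lam * t` jobs have arrived by `t`, so the bound `size j ≤ ε / (2 * lam)
  -- * j` gives `ε * t`; the finitely many small indices are handled separately.
  have hδ : 0 < ε / (2 * lam) := by positivity
  obtain ⟨M, hM⟩ := eventually_atTop.1 ((tendsto_size_div hJ).eventually_le_const hδ)
  have hsmall : ∀ᶠ t : ℝ in atTop, ∀ j ∈ Finset.range (M + 1), J.size j ≤ ε * t :=
    (Finset.eventually_all _).2 fun j _ =>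
      (tendsto_id.const_mul_atTop hε).eventually_ge_atTop (J.size j)
  filter_upwards [hsmall, (tendsto_arrivalCount_div hJ).eventually_le_const
    (by linarith : lam < 2 * lam), eventually_gt_atTop 0] with t h1 h2 ht j hj
  rcases le_or_gt j M with h | h
  · exact h1 j (by simpa [Nat.lt_succ_iff] using h)
  · have h3 := hM j h.le
    have hj0 : (0 : ℝ) < j := by exact_mod_cast (Nat.zero_le M).trans_lt h
    rw [div_le_iff₀ hj0] at h3
    rw [div_le_iff₀ ht] at h2
    have hjc : (j : ℝ) ≤ arrivalCount J t := by exact_mod_cast hj.le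
    calc J.size j ≤ ε / (2 * lam) * j := h3
      _ ≤ ε / (2 * lam) * (2 * lam * t) := by gcongr; exact hjc.trans h2
      _ = ε * t := by field_simp

lemma eventually_departed (hJ : IsErgodic J lam) {ε : ℝ} (hε : 0 < ε) :
    ∀ᶠ t in atTop, ∀ j < arrivalCount J ((1 - ε) * t), J.arrival j + J.size j ≤ t := by
  filter_upwards [eventually_size_le hJ hε, eventually_gt_atTop 0] with t h ht j hj
  have h1 := (lt_arrivalCount_iff hJ _ j).1 hj
  have h2 := h j ((lt_arrivalCount_iff hJ _ j).2 (by nlinarith))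
  linarith

lemma tendsto_scaled {f : ℝ → ℝ} (hf : Tendsto (fun t => f t / t) atTop (𝓝 lam)) {c : ℝ}
    (hc : 0 < c) : Tendsto (fun t => f (c * t) / t) atTop (𝓝 (c * lam)) := by
  refine ((hf.comp (tendsto_id.const_mul_atTop hc)).const_mul c).congr' ?_
  filter_upwards [eventually_gt_atTop 0] with t ht
  simp only [Function.comp, id]
  field_simp

lemma tendsto_arrivedWork_div (hJ : IsErgodic J lam) :
    Tendsto (fun t => (∑ j ∈ Finset.range (arrivalCount J t), J.size j) / t) atTop (𝓝 lam) := by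
  have := (hJ.tendsto_size.comp (tendsto_arrivalCount hJ)).mul (tendsto_arrivalCount_div hJ)
  rw [one_mul] at this
  refine this.congr' ?_
  filter_upwards [(tendsto_arrivalCount hJ).eventually_gt_atTop 0] with t ht
  have : (arrivalCount J t : ℝ) ≠ 0 := by positivity
  simp only [Function.comp]
  field_simp

lemma mem_range_arrivalCount (hJ : IsErgodic J lam) (t : ℝ) (j : ℕ) :
    j ∈ Finset.range (arrivalCount J t) ↔ J.arrival j ≤ t := by
  rw [Finset.mem_range, lt_arrivalCount_iff hJ]

/-- Little's law for the policy that serves every job. -/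
lemma tendsto_avg_active (hJ : IsErgodic J lam) :
    Tendsto (fun t => (1 / t) * ∫ u in (0 : ℝ)..t, ((active J u).ncard : ℝ)) atTop (𝓝 lam) := by
  have hl := hJ.rate_pos
  refine tendsto_order.2 ⟨fun a ha => ?_, fun a ha => ?_⟩
  -- Jobs arrived by `c * t` with `c < 1` have all left by `t`, so they count with their full size;
  -- their work grows at rate `c * lam`, still above `a`.
  · obtain ⟨c, hc, hc1⟩ : ∃ c, max 0 (a / lam) < c ∧ c < 1 :=
      exists_between (max_lt one_pos ((div_lt_one hl).2 ha))
    have hc0 : 0 < c := (le_max_left _ _).trans_lt hc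
    have hca : a < c * lam := (div_lt_iff₀ hl).1 ((le_max_right _ _).trans_lt hc)
    filter_upwards [(tendsto_scaled (tendsto_arrivedWork_div hJ) hc0).eventually_const_lt hca,
      eventually_departed hJ (sub_pos.2 hc1), eventually_gt_atTop 0] with t h1 h2 ht
    refine h1.trans_le ?_
    rw [integral_ncard_active hJ.toIsRegular ht.le (mem_range_arrivalCount hJ t), one_div,
      inv_mul_eq_div]
    gcongr
    rw [sub_sub_cancel] at h2
    calc ∑ j ∈ Finset.range (arrivalCount J (c * t)), J.size j
        = ∑ j ∈ Finset.range (arrivalCount J (c * t)), min (J.size j) (t - J.arrival j) := by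
          refine Finset.sum_congr rfl fun j hj => (min_eq_left ?_).symm
          linarith [h2 j (Finset.mem_range.1 hj)]
      _ ≤ _ := by
          refine Finset.sum_le_sum_of_subset_of_nonneg ?_ fun j hj _ => ?_
          · exact Finset.range_mono (arrivalCount_mono hJ (by nlinarith))
          · exact le_min (hJ.size_pos j).le
              (sub_nonneg.2 ((mem_range_arrivalCount hJ t j).1 hj))
  · filter_upwards [(tendsto_arrivedWork_div hJ).eventually_lt_const ha,
      eventually_gt_atTop 0] with t h1 ht
    refine lt_of_le_of_lt ?_ h1
    rw [integral_ncard_active hJ.toIsRegular ht.le (mem_range_arrivalCount hJ t), one_div,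
      inv_mul_eq_div]
    gcongr
    exact min_le_left _ _

lemma ncard_active_le (hJ : IsErgodic J lam) {s t : ℝ}
    (h : ∀ j < arrivalCount J s, J.arrival j + J.size j ≤ t) :
    (active J t).ncard ≤ arrivalCount J t - arrivalCount J s := by
  have hsub : active J t ⊆ (Finset.Ico (arrivalCount J s) (arrivalCount J t) : Set ℕ) := by
    intro j hj
    rw [Finset.coe_Ico]
    exact ⟨not_lt.1 fun hlt => (h j hlt).not_gt hj.2, (lt_arrivalCount_iff hJ t j).2 hj.1⟩
  have := ncard_le_ncard hsub (Finset.finite_toSet _)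
  rwa [ncard_coe_finset, Nat.card_Ico] at this

/-- Active jobs arrived during the last fraction `1 - c` of the time, for any `c < 1`. Hence
departures have the same rate as arrivals. -/
lemma tendsto_ncard_active_div (hJ : IsErgodic J lam) :
    Tendsto (fun t => ((active J t).ncard : ℝ) / t) atTop (𝓝 0) := by
  have hl := hJ.rate_pos
  refine tendsto_order.2 ⟨fun a ha => ?_, fun a ha => ?_⟩
  · filter_upwards [eventually_gt_atTop 0] with t ht
    exact ha.trans_le (by positivity)
  · obtain ⟨c, hc, hc1⟩ : ∃ c, max 0 (1 - a / lam) < c ∧ c < 1 :=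
      exists_between (max_lt one_pos (by linarith [div_pos ha hl]))
    have hc0 : 0 < c := (le_max_left _ _).trans_lt hc
    have hca : lam - c * lam < a := by
      have h1 : a / lam > 1 - c := by linarith [(le_max_right 0 (1 - a / lam)).trans_lt hc]
      have := (lt_div_iff₀ hl).1 h1
      linarith
    have hcount := tendsto_arrivalCount_div hJ
    have := hcount.sub (tendsto_scaled (f := fun t => (arrivalCount J t : ℝ)) hcount hc0)
    filter_upwards [this.eventually_lt_const hca,
      eventually_departed hJ (sub_pos.2 hc1), eventually_gt_atTop 0] with t h1 h2 ht
    refine lt_of_le_of_lt ?_ h1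
    rw [sub_sub_cancel] at h2
    have hct : c * t ≤ t := by nlinarith
    have h3 := ncard_active_le hJ h2
    rw [← sub_div, ← Nat.cast_sub (arrivalCount_mono hJ hct)]
    gcongr

/-! ### Switching cost when events are simple -/

/-- No two of the events (arrivals after time `0` and departures) are simultaneous. -/
structure HasSimpleEvents (J : JobStream) : Prop where
  departure_ne : ∀ j k, j ≠ k → J.arrival j + J.size j ≠ J.arrival k + J.size k
  departure_ne_arrival : ∀ j k, J.arrival j + J.size j ≠ J.arrival k
  arrival_ne : ∀ j k, j ≠ k → 0 < J.arrival j → J.arrival j ≠ J.arrival k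

lemma leftLim_ncard_active (hJ : IsRegular J) {s : ℝ → ℕ}
    (hs : ∀ t, 0 ≤ t → s t = (active J t).ncard) {u : ℝ} (hu : 0 < u) :
    Function.leftLim (fun v => (s v : ℝ)) u =
      {j | J.arrival j < u ∧ u ≤ J.arrival j + J.size j}.ncard := by
  refine leftLim_eq_of_tendsto (tendsto_const_nhds.congr' ?_)
  -- Only finitely many jobs arrive by `u`, so one left neighbourhood serves them all; passing to
  -- the left limit exchanges strict and weak inequalities.
  have hev : ∀ᶠ v in 𝓝[<] u, ∀ j ∈ {j | J.arrival j ≤ u},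
      (J.arrival j ≤ v ↔ J.arrival j < u) ∧
      (v < J.arrival j + J.size j ↔ u ≤ J.arrival j + J.size j) := by
    refine (eventually_all_finite (hJ.finite_arrivals u)).2 fun j _ => .and ?_ ?_
    · by_cases h : J.arrival j < u
      · filter_upwards [nhdsWithin_le_nhds (Ioi_mem_nhds h)] with v hv
        exact iff_of_true (le_of_lt hv) h
      · filter_upwards [self_mem_nhdsWithin] with v hv
        exact iff_of_false (fun h' => h (lt_of_le_of_lt h' hv)) h
    · by_cases h : u ≤ J.arrival j + J.size j
      · filter_upwards [self_mem_nhdsWithin] with v hv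
        exact iff_of_true (lt_of_lt_of_le hv h) h
      · filter_upwards [nhdsWithin_le_nhds (Ioi_mem_nhds (not_le.1 h))] with v hv
        exact iff_of_false (not_lt.2 (le_of_lt hv)) h
  filter_upwards [hev, self_mem_nhdsWithin, nhdsWithin_le_nhds (Ioi_mem_nhds hu)] with v hv hvu hv0
  rw [hs v (le_of_lt hv0)]
  congr 2
  ext j
  constructor
  · rintro ⟨h1, h2⟩
    exact ⟨(hv j h1.le).1.2 h1, (hv j h1.le).2.2 h2⟩
  · rintro ⟨h1, h2⟩
    have hju : J.arrival j ≤ u := h1.trans (le_of_lt hvu)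
    exact ⟨(hv j hju).1.1 h1, (hv j hju).2.1 h2⟩

lemma ncard_eq_sum_ite {A : Set ℕ} {F : Finset ℕ} [DecidablePred (· ∈ A)] (h : A ⊆ F) :
    (A.ncard : ℝ) = ∑ j ∈ F, if j ∈ A then (1 : ℝ) else 0 := by
  have : A = (F.filter (· ∈ A) : Finset ℕ) := by
    ext j; simpa using fun hj => h hj
  conv_lhs => rw [this]
  rw [ncard_coe_finset, Finset.card_filter]
  push_cast
  rfl

-- The jump is arrivals minus departures at `u`. Simplicity makes each count at most one and not
-- both one, and then the squared difference equals their sum. Initial jobs, which may share time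
-- `0`, do not interfere since `u > 0`.
open Classical in
lemma sq_jump_active (hJ : IsRegular J) (hE : HasSimpleEvents J) {s : ℝ → ℕ}
    (hs : ∀ t, 0 ≤ t → s t = (active J t).ncard) {u : ℝ} (hu : 0 < u) {F : Finset ℕ}
    (hF : ∀ j, J.arrival j ≤ u → j ∈ F) :
    ((s u : ℝ) - Function.leftLim (fun v => (s v : ℝ)) u) ^ 2 =
      ∑ j ∈ F, ((if J.arrival j = u then (1 : ℝ) else 0) +
        if J.arrival j + J.size j = u then 1 else 0) := by
  rw [leftLim_ncard_active hJ hs hu, hs u hu.le,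
    ncard_eq_sum_ite (F := F) (fun j hj => hF j hj.1),
    ncard_eq_sum_ite (F := F) (fun j hj => hF j (le_of_lt hj.1)), ← Finset.sum_sub_distrib]
  have hjump : ∀ j ∈ F, ((if j ∈ active J u then (1 : ℝ) else 0) -
      if j ∈ {j | J.arrival j < u ∧ u ≤ J.arrival j + J.size j} then 1 else 0) =
      (if J.arrival j = u then (1 : ℝ) else 0) -
        if J.arrival j + J.size j = u then 1 else 0 := by
    intro j _
    have := hJ.size_pos j
    simp only [active, mem_ofPred_eq]
    grind
  rw [Finset.sum_congr rfl hjump, Finset.sum_sub_distrib, Finset.sum_add_distrib]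
  simp only [Finset.sum_boole]
  have ha : (F.filter fun j => J.arrival j = u).card ≤ 1 := Finset.card_le_one.2 fun i hi j hj => by
    simp only [Finset.mem_filter] at hi hj
    by_contra hne
    exact hE.arrival_ne i j hne (hi.2 ▸ hu) (hi.2.trans hj.2.symm)
  have hd : (F.filter fun j => J.arrival j + J.size j = u).card ≤ 1 :=
    Finset.card_le_one.2 fun i hi j hj => by
      simp only [Finset.mem_filter] at hi hj
      by_contra hne
      exact hE.departure_ne i j hne (hi.2.trans hj.2.symm)
  rcases Finset.eq_empty_or_nonempty (F.filter fun j => J.arrival j = u) with h | ⟨i, hi⟩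
  · interval_cases hc : (F.filter fun j => J.arrival j + J.size j = u).card <;> simp [h]
  · have : (F.filter fun j => J.arrival j + J.size j = u) = ∅ := by
      refine Finset.eq_empty_of_forall_notMem fun j hj => ?_
      simp only [Finset.mem_filter] at hi hj
      exact hE.departure_ne_arrival j i (hj.2.trans hi.2.symm)
    interval_cases hc : (F.filter fun j => J.arrival j = u).card <;> simp [this]

open Classical in
/-- Every arrival after time `0` and every departure contributes one to the switching cost. -/
lemma switchingCost_active (hJ : IsErgodic J lam) (hE : HasSimpleEvents J) {s : ℝ → ℕ}
    (hs : ∀ t, 0 ≤ t → s t = (active J t).ncard) {t : ℝ} (ht : 0 ≤ t) :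
    switchingCost s t =
      2 * (arrivalCount J t : ℝ) - arrivalCount J 0 - (active J t).ncard := by
  set F := Finset.range (arrivalCount J t) with hFdef
  have hF : ∀ j, j ∈ F ↔ J.arrival j ≤ t := mem_range_arrivalCount hJ t
  set E : Finset ℝ := (F.image J.arrival ∪ F.image (fun j => J.arrival j + J.size j)).filter
    (· ∈ Ioc 0 t) with hEdef
  have hsq : ∀ u ∈ Ioc 0 t, ((s u : ℝ) - Function.leftLim (fun v => (s v : ℝ)) u) ^ 2 =
      ∑ j ∈ F, ((if J.arrival j = u then (1 : ℝ) else 0) +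
        if J.arrival j + J.size j = u then 1 else 0) := fun u hu =>
    sq_jump_active hJ.toIsRegular hE hs hu.1 fun j hj => (hF j).2 (hj.trans hu.2)
  have h1 : switchingCost s t = ∑ u ∈ E, ∑ j ∈ F, ((if J.arrival j = u then (1 : ℝ) else 0) +
        if J.arrival j + J.size j = u then 1 else 0) := by
    rw [switchingCost, finsum_mem_congr rfl hsq]
    refine finsum_mem_eq_sum_of_inter_support_eq _ ?_
    ext u
    simp only [mem_inter_iff, Function.mem_support, hEdef, Finset.coe_filter, mem_ofPred_eq]
    constructor
    · rintro ⟨hu, hne⟩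
      refine ⟨⟨?_, hu⟩, hne⟩
      obtain ⟨j, hj, hj'⟩ := Finset.exists_ne_zero_of_sum_ne_zero hne
      rw [Finset.mem_union, Finset.mem_image, Finset.mem_image]
      by_cases h : J.arrival j = u
      · exact .inl ⟨j, hj, h⟩
      · by_cases h2 : J.arrival j + J.size j = u
        · exact .inr ⟨j, hj, h2⟩
        · simp [h, h2] at hj'
    · rintro ⟨⟨_, hu⟩, hne⟩
      exact ⟨hu, hne⟩
  have hA : ∀ j ∈ F, (J.arrival j ∈ E ↔ ¬ J.arrival j ≤ 0) := fun j hj => by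
    simp only [hEdef, Finset.mem_filter, Finset.mem_union, mem_Ioc, not_le]
    exact ⟨fun h => h.2.1, fun h => ⟨.inl (Finset.mem_image_of_mem _ hj), h, (hF j).1 hj⟩⟩
  have hD : ∀ j ∈ F, (J.arrival j + J.size j ∈ E ↔ ¬ j ∈ active J t) := fun j hj => by
    have hjt := (hF j).1 hj
    have := hJ.size_pos j
    have := hJ.arrival_nonneg j
    simp only [hEdef, Finset.mem_filter, Finset.mem_union, mem_Ioc, active, mem_ofPred_eq, not_and,
      not_lt]
    exact ⟨fun h _ => h.2.2, fun h => ⟨.inr (Finset.mem_image_of_mem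
      (fun j => J.arrival j + J.size j) hj), by linarith, h hjt⟩⟩
  have hsum0 : ∑ j ∈ F, (if J.arrival j ≤ 0 then (1 : ℝ) else 0) = arrivalCount J 0 := by
    have := ncard_eq_sum_ite (A := {j | J.arrival j ≤ 0}) (F := F)
      fun j hj => (hF j).2 (le_trans hj ht)
    rw [arrivalCount, this]
    rfl
  have hsumA : ∑ j ∈ F, (if j ∈ active J t then (1 : ℝ) else 0) = (active J t).ncard :=
    (ncard_eq_sum_ite fun j hj => (hF j).2 hj.1).symm
  have hsum1 : ∑ j ∈ F, (1 : ℝ) = arrivalCount J t := by simp [hFdef]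
  have hterm : ∀ j ∈ F, ∑ u ∈ E, ((if J.arrival j = u then (1 : ℝ) else 0) +
        if J.arrival j + J.size j = u then 1 else 0) =
      (1 - (if J.arrival j ≤ 0 then 1 else 0)) + (1 - if j ∈ active J t then 1 else 0) := by
    intro j hj
    rw [Finset.sum_add_distrib, Finset.sum_ite_eq, Finset.sum_ite_eq, if_congr (hA j hj) rfl rfl,
      if_congr (hD j hj) rfl rfl]
    split_ifs <;> norm_num
  -- Summing over jobs first: a job contributes one unless it arrived at time `0`, and one more
  -- unless it is still active at `t`.
  rw [h1, Finset.sum_comm, Finset.sum_congr rfl hterm, Finset.sum_add_distrib,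
    Finset.sum_sub_distrib, Finset.sum_sub_distrib, hsum0, hsumA, hsum1]
  ring

lemma tendsto_switchingCost_active (hJ : IsErgodic J lam) (hE : HasSimpleEvents J) {s : ℝ → ℕ}
    (hs : ∀ t, 0 ≤ t → s t = (active J t).ncard) :
    Tendsto (fun t => switchingCost s t / t) atTop (𝓝 (2 * lam)) := by
  have h := (((tendsto_arrivalCount_div hJ).const_mul 2).sub
    ((tendsto_const_nhds (x := (arrivalCount J 0 : ℝ))).div_atTop tendsto_id)).sub
    (tendsto_ncard_active_div hJ)
  rw [sub_zero, sub_zero] at h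
  refine h.congr' ?_
  filter_upwards [eventually_ge_atTop 0] with t ht
  rw [switchingCost_active hJ hE hs ht]
  simp only [id]
  ring

end Multiserver

/-! ### Exponential laws and almost sure properties of the input -/

namespace Multiserver

lemma expMeasure_eq_withDensity (r : ℝ) : expMeasure r =
    (volume.restrict (Ioi 0)).withDensity fun x => ENNReal.ofReal (r * Real.exp (-(r * x))) := by
  have : gammaPDF 1 r = (Ici (0 : ℝ)).indicator
      fun x => ENNReal.ofReal (r * Real.exp (-(r * x))) := by
    ext x
    have := exponentialPDF_eq r x
    rw [exponentialPDF, exponentialPDFReal] at this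
    rw [gammaPDF, this]
    by_cases h : 0 ≤ x <;> simp [h]
  rw [expMeasure, gammaMeasure, this, withDensity_indicator measurableSet_Ici,
    restrict_Ioi_eq_restrict_Ici]

lemma integral_expMeasure {E : Type*} [NormedAddCommGroup E] [NormedSpace ℝ E] {r : ℝ}
    (hr : 0 < r) (f : ℝ → E) :
    ∫ x, f x ∂(expMeasure r) = ∫ x in Ioi 0, (r * Real.exp (-(r * x))) • f x := by
  rw [expMeasure_eq_withDensity, integral_withDensity_eq_integral_toReal_smul (by fun_prop)
    (by simp)]
  refine integral_congr_ae (.of_forall fun x => ?_)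
  simp only
  rw [ENNReal.toReal_ofReal (by positivity)]

instance nullSingletonClass_expMeasure (r : ℝ) : NullSingletonClass (expMeasure r) where
  measure_singleton x := by
    rw [expMeasure_eq_withDensity]
    exact withDensity_absolutelyContinuous _ _ (measure_singleton x)

lemma ae_pos_expMeasure (r : ℝ) : ∀ᵐ x ∂(expMeasure r), 0 < x := by
  rw [expMeasure_eq_withDensity]
  exact (withDensity_absolutelyContinuous _ _).ae_le (ae_restrict_mem measurableSet_Ioi)

lemma integral_id_expMeasure {r : ℝ} (hr : 0 < r) : ∫ x, x ∂(expMeasure r) = r⁻¹ := by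
  rw [integral_expMeasure hr]
  have h := Real.integral_rpow_mul_exp_neg_mul_Ioi (a := 2) two_pos hr
  have : ∫ x in Ioi (0 : ℝ), (r * Real.exp (-(r * x))) • x =
      r * ∫ t in Ioi (0 : ℝ), t ^ ((2 : ℝ) - 1) * Real.exp (-(r * t)) := by
    rw [← integral_const_mul]
    refine setIntegral_congr_fun measurableSet_Ioi fun x _ => ?_
    norm_num
    ring
  rw [this, h]
  norm_num
  field_simp

lemma integrable_id_expMeasure {r : ℝ} (hr : 0 < r) : Integrable (fun x => x) (expMeasure r) := by
  -- A non-integrable function has integral `0` by convention, contradicting the computed value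
  -- `r⁻¹`.
  by_contra h
  have := integral_undef h
  rw [integral_id_expMeasure hr] at this
  exact (inv_pos.2 hr).ne' this

section Stochastic

variable {Ω : Type*} [MeasurableSpace Ω] {P : Measure Ω} {lam : ℝ≥0}
  {N₀ : Ω → ℕ} {T S : ℕ → Ω → ℝ}

/-- By Fubini: for each fixed value of `X`, the atomless law of `Y` gives no mass to the single
point `f (X ω)`. -/
lemma ae_ne_of_indepFun [IsProbabilityMeasure P] {α : Type*} [MeasurableSpace α] {X : Ω → α}
    {Y : Ω → ℝ} (hX : Measurable X) (hY : Measurable Y) (h : IndepFun X Y P) [NullSingletonClass (P.map Y)]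
    {f : α → ℝ} (hf : Measurable f) : ∀ᵐ ω ∂P, Y ω ≠ f (X ω) := by
  have hset : MeasurableSet {p : α × ℝ | p.2 ≠ f p.1} :=
    (measurableSet_eq_fun measurable_snd (hf.comp measurable_fst)).compl
  have : ∀ᵐ p ∂(P.map fun ω => (X ω, Y ω)), p.2 ≠ f p.1 := by
    have := Measure.isProbabilityMeasure_map (μ := P) hX.aemeasurable
    have := Measure.isProbabilityMeasure_map (μ := P) hY.aemeasurable
    rw [(indepFun_iff_map_prod_eq_prod_map_map hX.aemeasurable hY.aemeasurable).1 h,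
      Measure.ae_prod_iff_ae_ae hset]
    exact .of_forall fun x => by simp [ae_iff]
  exact ae_of_ae_map (hX.prodMk hY).aemeasurable this

lemma strong_law_expMeasure {X : ℕ → Ω → ℝ} {r : ℝ} (hr : 0 < r)
    (hX : ∀ i, HasLaw (X i) (expMeasure r) P) (hind : iIndepFun X P) :
    ∀ᵐ ω ∂P, Tendsto (fun n : ℕ => (∑ i ∈ Finset.range n, X i ω) / n) atTop (𝓝 r⁻¹) := by
  have hint : Integrable (X 0) P := by
    have := integrable_id_expMeasure hr
    rw [← (hX 0).map_eq] at this
    exact this.comp_aemeasurable (hX 0).aemeasurable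
  have := strong_law_ae_real X hint (fun i j hij => hind.indepFun hij)
    fun i => ⟨(hX i).aemeasurable, (hX 0).aemeasurable, by rw [(hX i).map_eq, (hX 0).map_eq]⟩
  rwa [(hX 0).integral_eq, integral_id_expMeasure hr] at this

lemma isErgodic_jobStream (N : ℕ) {T S : ℕ → ℝ} {lam : ℝ} (hlam : 0 < lam) (hT : ∀ i, 0 < T i)
    (hS : ∀ j, 0 < S j)
    (hT' : Tendsto (fun n : ℕ => (∑ i ∈ Finset.range n, T i) / n) atTop (𝓝 lam⁻¹))
    (hS' : Tendsto (fun n : ℕ => (∑ i ∈ Finset.range n, S i) / n) atTop (𝓝 1)) :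
    IsErgodic (jobStream N T S) lam := by
  have hmono : Monotone (fun n => ∑ i ∈ Finset.range n, T i) :=
    monotone_nat_of_le_succ fun n => by rw [Finset.sum_range_succ]; linarith [hT n]
  have hnn : ∀ n, 0 ≤ ∑ i ∈ Finset.range n, T i := fun n => Finset.sum_nonneg fun i _ => (hT i).le
  have htend : Tendsto (fun n : ℕ => (jobStream N T S).arrival n / n) atTop (𝓝 lam⁻¹) := by
    rw [← tendsto_add_atTop_iff_nat N]
    have h1 := (tendsto_add_atTop_iff_nat 1).2 hT'
    -- Job `n + N` arrives at a sum of `n + 1` interarrival times; this factor corrects the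
    -- denominator.
    have h2 : Tendsto (fun n : ℕ => ((n : ℝ) + 1) / (n + N)) atTop (𝓝 1) := by
      have := (tendsto_natCast_div_add_atTop (N : ℝ)).div
        (tendsto_natCast_div_add_atTop (1 : ℝ)) one_ne_zero
      rw [div_one] at this
      refine this.congr' ?_
      filter_upwards [eventually_gt_atTop 0] with n hn
      have : (n : ℝ) ≠ 0 := by positivity
      simp only [Pi.div_apply]
      field_simp
    have := h1.mul h2
    rw [mul_one] at this
    refine this.congr' ?_
    filter_upwards with n
    have : ¬ (n + N < N) := by lia
    simp only [jobStream, this, if_false, Nat.add_sub_cancel]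
    push_cast
    field_simp
  refine ⟨⟨fun j => ?_, hS, fun t => ?_⟩, hlam, ?_, htend, hS'⟩
  · simp only [jobStream]
    split_ifs
    exacts [le_rfl, hnn _]
  · have : Tendsto (jobStream N T S).arrival atTop atTop := by
      refine (htend.pos_mul_atTop (inv_pos.2 hlam) tendsto_natCast_atTop_atTop).congr' ?_
      filter_upwards [eventually_gt_atTop 0] with n hn
      have : (n : ℝ) ≠ 0 := by positivity
      field_simp
    have := this.eventually_gt_atTop t
    rw [← Nat.cofinite_eq_atTop, eventually_cofinite] at this
    simpa using this
  · intro j k hjk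
    simp only [jobStream]
    split_ifs with h1 h2 h2
    · exact le_rfl
    · exact hnn _
    · lia
    · exact hmono (by lia)

lemma ae_isErgodic_input (hlam : 0 < lam) (hin : IsPoissonExpInput P lam N₀ T S) :
    ∀ᵐ ω ∂P, IsErgodic (input N₀ T S ω) lam := by
  have hT := ae_all_iff.2 fun i =>
    ((hin.law_interarrival i).ae_iff (p := fun x => 0 < x) (by fun_prop)).2 (ae_pos_expMeasure _)
  have hS := ae_all_iff.2 fun i =>
    ((hin.law_size i).ae_iff (p := fun x => 0 < x) (by fun_prop)).2 (ae_pos_expMeasure _)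
  filter_upwards [hT, hS, strong_law_expMeasure (NNReal.coe_pos.2 hlam) hin.law_interarrival
    hin.indep_interarrival, strong_law_expMeasure one_pos hin.law_size hin.indep_size]
    with ω h1 h2 h3 h4
  rw [inv_one] at h4
  exact isErgodic_jobStream _ hlam h1 h2 h3 h4

lemma measurable_arrival_jobStream (N : ℕ) (j : ℕ) :
    Measurable fun T : ℕ → ℝ => (jobStream N T 0).arrival j := by
  simp only [jobStream]
  split_ifs <;> fun_prop

lemma ae_hasSimpleEvents_input [IsProbabilityMeasure P] (hin : IsPoissonExpInput P lam N₀ T S) :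
    ∀ᵐ ω ∂P, HasSimpleEvents (input N₀ T S ω) := by
  have hTm : Measurable fun ω i => T i ω := measurable_pi_iff.2 hin.measurable_interarrival
  have hmap : ∀ j, P.map (S j) = expMeasure 1 := fun j => (hin.law_size j).map_eq
  -- The exceptional sets are removed for every deterministic `N`, a countable family, so that `N =
  -- N₀ ω` can be substituted afterwards. Arrival times ignore sizes, hence the dummy size `0`.
  have h1 : ∀ᵐ ω ∂P, ∀ N j k : ℕ, S j ω ≠
      (jobStream N (fun i => T i ω) 0).arrival k - (jobStream N (fun i => T i ω) 0).arrival j := by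
    simp only [ae_all_iff]
    intro N j k
    have : NullSingletonClass (P.map (S j)) := by rw [hmap]; infer_instance
    exact ae_ne_of_indepFun hTm (hin.measurable_size j)
      (hin.indep_interarrival_size.comp measurable_id (measurable_pi_apply j))
      ((measurable_arrival_jobStream N k).sub (measurable_arrival_jobStream N j))
  have h2 : ∀ᵐ ω ∂P, ∀ N j k : ℕ, j ≠ k → S j ω - S k ω ≠
      (jobStream N (fun i => T i ω) 0).arrival k - (jobStream N (fun i => T i ω) 0).arrival j := by
    simp only [ae_all_iff]
    intro N j k hjk
    have : NullSingletonClass (P.map (S j)) := by rw [hmap]; infer_instance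
    have : NullSingletonClass (P.map fun ω => S j ω - S k ω) := ⟨fun c => by
      have hm : Measurable fun ω => S j ω - S k ω :=
        (hin.measurable_size j).sub (hin.measurable_size k)
      rw [Measure.map_apply hm (measurableSet_singleton c)]
      have := ae_ne_of_indepFun (hin.measurable_size k) (hin.measurable_size j)
        (hin.indep_size.indepFun hjk.symm) (f := fun s => s + c) (by fun_prop)
      refine measure_mono_null (fun ω hω => ?_) (ae_iff.1 this)
      simp only [mem_preimage, mem_singleton_iff] at hω
      simp only [mem_ofPred_eq, not_not]
      linarith⟩
    exact ae_ne_of_indepFun hTm ((hin.measurable_size j).sub (hin.measurable_size k))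
      (hin.indep_interarrival_size.comp measurable_id
        ((measurable_pi_apply j).sub (measurable_pi_apply k)))
      ((measurable_arrival_jobStream N k).sub (measurable_arrival_jobStream N j))
  have hT := ae_all_iff.2 fun i =>
    ((hin.law_interarrival i).ae_iff (p := fun x => 0 < x) (by fun_prop)).2 (ae_pos_expMeasure _)
  filter_upwards [h1, h2, hT] with ω h1 h2 h3
  have hmono : StrictMono (fun n => ∑ i ∈ Finset.range n, T i ω) :=
    strictMono_nat_of_lt_succ fun n => by rw [Finset.sum_range_succ]; linarith [h3 n]
  refine ⟨fun j k hjk h => ?_, fun j k h => ?_, fun j k hjk hpos h => ?_⟩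
  · refine h2 (N₀ ω) j k hjk ?_
    simp only [input, jobStream] at h ⊢
    linarith
  · refine h1 (N₀ ω) j k ?_
    simp only [input, jobStream] at h ⊢
    linarith
  · rw [h] at hpos
    have hk : ¬ k < N₀ ω := fun hk => by simp [input, jobStream, hk] at hpos
    rw [← h] at hpos
    have hj : ¬ j < N₀ ω := fun hj => by simp [input, jobStream, hj] at hpos
    simp only [input, jobStream, hj, hk, if_false] at h
    have := hmono.injective h
    lia

end Stochastic

end Multiserver

/-! ### Generating functions and the renewal equation of the `M/M/∞` queue -/

namespace Multiserver

/-- Prepend a term to a sequence. -/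
def consSeq (p : ℝ × (ℕ → ℝ)) : ℕ → ℝ
  | 0 => p.1
  | n + 1 => p.2 n

lemma measurable_consSeq : Measurable consSeq := by
  refine measurable_pi_iff.2 fun n => ?_
  cases n with
  | zero => exact measurable_fst
  | succ n => exact (measurable_pi_apply n).comp measurable_snd

/-- The law of an i.i.d. sequence is invariant under prepending an independent term. -/
lemma map_consSeq (μ : Measure ℝ) [IsProbabilityMeasure μ] :
    (μ.prod (Measure.infinitePi fun _ : ℕ => μ)).map consSeq =
      Measure.infinitePi fun _ : ℕ => μ := by
  classical
  refine Measure.eq_infinitePi _ fun s t ht => ?_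
  obtain ⟨n, hn⟩ : ∃ n, s ⊆ Finset.range (n + 1) := by
    refine ⟨s.sup id, fun i hi => ?_⟩
    simpa [Nat.lt_succ_iff] using Finset.le_sup (f := id) hi
  -- Padding with `univ` replaces the index set by an initial segment, where prepending is an index
  -- shift.
  set t' : ℕ → Set ℝ := fun i => if i ∈ s then t i else univ with ht'
  have hm : ∀ i, MeasurableSet (t' i) := fun i => by
    simp only [ht']; split_ifs; exacts [ht i, .univ]
  have hpi : Set.pi s t = Set.pi (Finset.range (n + 1)) t' := by
    ext x
    simp only [Set.mem_pi, Finset.mem_coe, ht']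
    constructor
    · intro h i _
      split_ifs with hi
      exacts [h i hi, trivial]
    · intro h i hi
      simpa [hi] using h i (hn hi)
  have hprod : ∏ i ∈ s, μ (t i) = ∏ i ∈ Finset.range (n + 1), μ (t' i) := by
    refine Finset.prod_subset_one_on_sdiff hn (fun i hi => ?_) fun i hi => by simp [ht', hi]
    simp [ht', (Finset.mem_sdiff.1 hi).2]
  have hpre : consSeq ⁻¹' (Set.pi (Finset.range (n + 1)) t') =
      t' 0 ×ˢ Set.pi (Finset.range n) fun i => t' (i + 1) := by
    ext ⟨a, x⟩
    simp only [mem_preimage, Set.mem_pi, Finset.mem_coe, Finset.mem_range, mem_prod]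
    constructor
    · intro h
      exact ⟨h 0 n.succ_pos, fun i hi => h (i + 1) (Nat.succ_lt_succ hi)⟩
    · rintro ⟨h0, h⟩ i hi
      cases i with
      | zero => exact h0
      | succ i => exact h i (Nat.lt_of_succ_lt_succ hi)
  rw [hpi, hprod, Measure.map_apply measurable_consSeq
    (.pi (Finset.countable_toSet _) fun i _ => hm i), hpre, Measure.prod_prod,
    Measure.infinitePi_pi _ fun i _ => hm _, Finset.prod_range_succ', mul_comm]

lemma integral_infinitePi_consSeq (μ : Measure ℝ) [IsProbabilityMeasure μ] {f : (ℕ → ℝ) → ℂ}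
    (hf : Measurable f) {C : ℝ} (hC : ∀ x, ‖f x‖ ≤ C) :
    ∫ x, f x ∂(Measure.infinitePi fun _ : ℕ => μ) =
      ∫ a, ∫ x, f (consSeq (a, x)) ∂(Measure.infinitePi fun _ : ℕ => μ) ∂μ := by
  conv_lhs => rw [← map_consSeq μ]
  rw [integral_map measurable_consSeq.aemeasurable hf.aestronglyMeasurable, integral_prod]
  exact .of_bound (hf.comp measurable_consSeq).aestronglyMeasurable C (.of_forall fun x => hC _)

lemma norm_prod_le_one {ι : Type*} (s : Finset ι) {f : ι → ℂ} (h : ∀ i ∈ s, ‖f i‖ ≤ 1) :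
    ‖∏ i ∈ s, f i‖ ≤ 1 := by
  rw [norm_prod]
  exact Finset.prod_le_one (fun _ _ => norm_nonneg _) h

lemma integral_prod_infinitePi (μ : Measure ℝ) [IsProbabilityMeasure μ] (n : ℕ) :
    ∀ {f : ℕ → ℝ → ℂ}, (∀ j, Measurable (f j)) → (∀ j x, ‖f j x‖ ≤ 1) →
    ∫ x, ∏ j ∈ Finset.range n, f j (x j) ∂(Measure.infinitePi fun _ : ℕ => μ) =
      ∏ j ∈ Finset.range n, ∫ a, f j a ∂μ := by
  induction n with
  | zero => intros; simp
  | succ n ih =>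
    intro f hf hb
    rw [integral_infinitePi_consSeq μ (C := 1) (f := fun x => ∏ j ∈ Finset.range (n + 1), f j (x j))
      (Finset.measurable_prod _ fun j _ => (hf j).comp (measurable_pi_apply j))
      fun x => norm_prod_le_one _ fun j _ => hb j _]
    simp only [Finset.prod_range_succ', consSeq]
    simp only [integral_mul_const, integral_const_mul]
    rw [ih (fun j => hf (j + 1)) fun j => hb (j + 1)]

/-- Generating function, at `z`, of the indicator that a job is in service at age `r`; a job that
has not yet arrived has negative age. -/
noncomputable def survGen (z : ℂ) (r : ℝ) : ℂ :=
  if 0 ≤ r then 1 - (1 - z) * Real.exp (-r) else 1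

lemma measurable_survGen (z : ℂ) : Measurable (survGen z) :=
  Measurable.ite measurableSet_Ici (by fun_prop) measurable_const

lemma survGen_of_nonneg (z : ℂ) {r : ℝ} (hr : 0 ≤ r) :
    survGen z r = 1 - (1 - z) * Real.exp (-r) := if_pos hr

lemma survGen_of_neg (z : ℂ) {r : ℝ} (hr : r < 0) : survGen z r = 1 := if_neg hr.not_ge

/-- At nonnegative age the value is a convex combination of `1` and `z`. -/
lemma norm_survGen_le {z : ℂ} (hz : ‖z‖ ≤ 1) (r : ℝ) : ‖survGen z r‖ ≤ 1 := by
  rcases lt_or_ge r 0 with hr | hr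
  · simp [survGen_of_neg z hr]
  · have h1 : Real.exp (-r) ≤ 1 := Real.exp_le_one_iff.2 (by linarith)
    have h0 := Real.exp_pos (-r)
    have : survGen z r = ((1 - Real.exp (-r) : ℝ) : ℂ) + z * (Real.exp (-r) : ℝ) := by
      rw [survGen_of_nonneg z hr]; push_cast; ring
    rw [this]
    refine (norm_add_le _ _).trans ?_
    rw [norm_mul, Complex.norm_real, Complex.norm_real, Real.norm_of_nonneg (by linarith),
      Real.norm_of_nonneg h0.le]
    nlinarith

lemma measureReal_expMeasure_Ioi {r : ℝ} (hr : 0 < r) {t : ℝ} (ht : 0 ≤ t) :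
    (expMeasure r).real (Ioi t) = Real.exp (-(r * t)) := by
  have := isProbabilityMeasure_expMeasure hr
  rw [← compl_Iic, measureReal_compl measurableSet_Iic, ← cdf_eq_real, cdf_expMeasure_eq hr,
    if_pos ht]
  simp

open Classical in
/-- A job arriving at `a` with an exponential size is in service at time `t` with probability
`exp (-(t - a))`. -/
lemma integral_size_expMeasure (z : ℂ) (a t : ℝ) :
    ∫ s, (if a ≤ t ∧ t < a + s then z else 1) ∂(expMeasure 1) = survGen z (t - a) := by
  have := isProbabilityMeasure_expMeasure one_pos
  rcases le_or_gt a t with h | h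
  · have : ∀ s : ℝ, (if a ≤ t ∧ t < a + s then z else 1) =
        1 + (Ioi (t - a)).indicator (fun _ => z - 1) s := fun s => by
      by_cases hs : t < a + s
      · rw [if_pos ⟨h, hs⟩, indicator_of_mem (by simp only [mem_Ioi]; linarith)]; ring
      · rw [if_neg fun h' => hs h'.2, indicator_of_notMem (by simp only [mem_Ioi]; linarith)]; ring
    simp only [this]
    rw [integral_add (integrable_const _) ((integrable_const _).indicator measurableSet_Ioi),
      integral_indicator measurableSet_Ioi, setIntegral_const,
      measureReal_expMeasure_Ioi one_pos (sub_nonneg.2 h), survGen_of_nonneg z (sub_nonneg.2 h)]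
    simp
    ring
  · rw [survGen_of_neg z (sub_neg.2 h)]
    simp [h.not_ge]

/-- Generating function of the number of busy servers at time `t` in the `M/M/∞` queue with
arrival rate `r` that starts empty. -/
noncomputable def busyGen (r : ℝ) (z : ℂ) (t : ℝ) : ℂ :=
  if 0 ≤ t then Complex.exp (-(r * (1 - z) * (1 - Real.exp (-t)))) else 1

lemma busyGen_of_nonneg (r : ℝ) (z : ℂ) {t : ℝ} (ht : 0 ≤ t) :
    busyGen r z t = Complex.exp (-(r * (1 - z) * (1 - Real.exp (-t)))) := if_pos ht

lemma busyGen_of_neg (r : ℝ) (z : ℂ) {t : ℝ} (ht : t < 0) : busyGen r z t = 1 := if_neg ht.not_ge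

lemma measurable_busyGen (r : ℝ) (z : ℂ) : Measurable (busyGen r z) :=
  Measurable.ite measurableSet_Ici (by fun_prop) measurable_const

lemma norm_busyGen_le {r : ℝ} (hr : 0 < r) {z : ℂ} (hz : ‖z‖ ≤ 1) (t : ℝ) :
    ‖busyGen r z t‖ ≤ 1 := by
  rcases lt_or_ge t 0 with ht | ht
  · simp [busyGen_of_neg r z ht]
  · rw [busyGen_of_nonneg r z ht, Complex.norm_exp]
    have h1 : Real.exp (-t) ≤ 1 := Real.exp_le_one_iff.2 (by linarith)
    have h2 : z.re ≤ 1 := (Complex.re_le_norm z).trans hz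
    have : (-(r * (1 - z) * (1 - Real.exp (-t)) : ℂ)).re =
        -(r * (1 - z.re) * (1 - Real.exp (-t))) := by
      rw [← Complex.ofReal_one, ← Complex.ofReal_sub, Complex.neg_re, Complex.re_mul_ofReal,
        Complex.re_ofReal_mul]
      simp
    rw [this, Real.exp_le_one_iff]
    have := mul_nonneg (mul_nonneg hr.le (sub_nonneg.2 h2)) (sub_nonneg.2 h1)
    linarith

/-- An explicit antiderivative of the renewal integrand on `[0, t]`. -/
lemma hasDerivAt_exp_mul_busyGen (r : ℝ) (z : ℂ) (t u : ℝ) :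
    HasDerivAt (fun u : ℝ => -((Real.exp (-(r * u)) : ℝ) : ℂ) *
        Complex.exp (-(r * (1 - z) * (1 - Real.exp (-(t - u))))))
      ((r * Real.exp (-(r * u)) : ℝ) * ((1 - (1 - z) * Real.exp (-(t - u))) *
        Complex.exp (-(r * (1 - z) * (1 - Real.exp (-(t - u))))))) u := by
  have h1 : HasDerivAt (fun u : ℝ => -((Real.exp (-(r * u)) : ℝ) : ℂ))
      ((r * Real.exp (-(r * u)) : ℝ) : ℂ) u := by
    have := (hasDerivAt_neg_exp_mul_exp (r := r) (x := u)).ofReal_comp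
    simpa using this
  have h2 : HasDerivAt (fun u : ℝ => ((Real.exp (-(t - u)) : ℝ) : ℂ))
      ((Real.exp (-(t - u)) : ℝ) : ℂ) u := by
    have : HasDerivAt (fun u : ℝ => Real.exp (-(t - u))) (Real.exp (-(t - u))) u := by
      have := ((hasDerivAt_id u).const_sub t).neg.exp
      simpa using this
    exact this.ofReal_comp
  have h3 := ((h2.const_sub 1).const_mul ((r : ℂ) * (1 - z))).neg.cexp
  convert! h1.mul h3 using 1
  simp only [Pi.neg_apply]
  push_cast
  ring

/-- Renewal equation: condition on the first arrival. -/
lemma integral_survGen_mul_busyGen {r : ℝ} (hr : 0 < r) (z : ℂ) {t : ℝ} (ht : 0 ≤ t) :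
    ∫ u, survGen z (t - u) * busyGen r z (t - u) ∂(expMeasure r) = busyGen r z t := by
  rw [integral_expMeasure hr]
  set f : ℝ → ℂ := fun u => (r * Real.exp (-(r * u))) •
    (survGen z (t - u) * busyGen r z (t - u)) with hf
  set g : ℝ → ℂ := fun u => (r * Real.exp (-(r * u)) : ℝ) * ((1 - (1 - z) * Real.exp (-(t - u))) *
        Complex.exp (-(r * (1 - z) * (1 - Real.exp (-(t - u)))))) with hg
  have hgc : Continuous g := by fun_prop
  have h1 : EqOn g f (Ioc 0 t) := fun u hu => by
    have : 0 ≤ t - u := sub_nonneg.2 hu.2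
    simp only [hf, hg, survGen_of_nonneg z this, busyGen_of_nonneg r z this, Complex.real_smul]
  have h2 : EqOn (fun u => ((r * Real.exp (-r * u) : ℝ) : ℂ)) f (Ioi t) := fun u hu => by
    have : t - u < 0 := sub_neg.2 hu
    simp only [hf, survGen_of_neg z this, busyGen_of_neg r z this, Complex.real_smul]
    simp
  have hi1 : IntegrableOn f (Ioc 0 t) :=
    (hgc.integrableOn_Ioc (a := 0) (b := t)).congr_fun h1 measurableSet_Ioc
  have hi2 : IntegrableOn f (Ioi t) :=
    IntegrableOn.congr_fun (((integrableOn_exp_mul_Ioi (neg_lt_zero.2 hr) t).const_mul r).ofReal)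
      h2 measurableSet_Ioi
  -- A first arrival after `t` leaves the queue empty and contributes `exp (-(r * t))`, which
  -- cancels the boundary term at `u = t`.
  rw [← Ioc_union_Ioi_eq_Ioi ht, setIntegral_union (Ioc_disjoint_Ioi le_rfl) measurableSet_Ioi
    hi1 hi2, ← setIntegral_congr_fun measurableSet_Ioc h1,
    ← setIntegral_congr_fun measurableSet_Ioi h2, ← intervalIntegral.integral_of_le ht,
    intervalIntegral.integral_eq_sub_of_hasDerivAt
      (fun u _ => hasDerivAt_exp_mul_busyGen r z t u) (hgc.intervalIntegrable _ _),
    integral_complex_ofReal, integral_const_mul, integral_exp_mul_Ioi (neg_lt_zero.2 hr),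
    busyGen_of_nonneg r z ht]
  have : r * (-Real.exp (-r * t) / -r) = Real.exp (-(r * t)) := by
    field_simp
  rw [this]
  simp

end Multiserver

/-! ### Truncation to finitely many arrivals -/

namespace Multiserver

/-- The law of i.i.d. exponential sequences. -/
noncomputable abbrev expSeqMeasure (r : ℝ) : Measure (ℕ → ℝ) :=
  Measure.infinitePi fun _ : ℕ => expMeasure r

/-- Generating function of the number of busy servers at time `t` that counts only the first `K`
arrivals. -/
noncomputable def busyGenTrunc (r : ℝ) (z : ℂ) (K : ℕ) (t : ℝ) : ℂ :=
  ∫ T, ∏ k ∈ Finset.range K, survGen z (t - ∑ i ∈ Finset.range (k + 1), T i) ∂(expSeqMeasure r)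

lemma measurable_prod_survGen (z : ℂ) (K : ℕ) : Measurable fun p : ℝ × (ℕ → ℝ) =>
    ∏ k ∈ Finset.range K, survGen z (p.1 - ∑ i ∈ Finset.range (k + 1), p.2 i) :=
  Finset.measurable_prod _ fun _ _ => (measurable_survGen z).comp (by fun_prop)

variable {r : ℝ} {z : ℂ}

lemma measurable_busyGenTrunc (hr : 0 < r) (K : ℕ) : Measurable (busyGenTrunc r z K) := by
  have := isProbabilityMeasure_expMeasure hr
  exact (measurable_prod_survGen z K).stronglyMeasurable.integral_prod_right.measurable

lemma norm_busyGenTrunc_le (hr : 0 < r) (hz : ‖z‖ ≤ 1) (K : ℕ) (t : ℝ) :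
    ‖busyGenTrunc r z K t‖ ≤ 1 := by
  have := isProbabilityMeasure_expMeasure hr
  refine (norm_integral_le_of_norm_le_const (C := 1) (.of_forall fun T => ?_)).trans (by simp)
  exact norm_prod_le_one _ fun k _ => norm_survGen_le hz _

/-- Given that the first arrival occurs at `u`, its job has age `t - u`, and the next `K` arrivals
restart the process with time `t - u` left. -/
lemma busyGenTrunc_succ (hr : 0 < r) (hz : ‖z‖ ≤ 1) (K : ℕ) (t : ℝ) :
    busyGenTrunc r z (K + 1) t =
      ∫ u, survGen z (t - u) * busyGenTrunc r z K (t - u) ∂(expMeasure r) := by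
  have := isProbabilityMeasure_expMeasure hr
  rw [busyGenTrunc, integral_infinitePi_consSeq (expMeasure r) (C := 1)
    (f := fun T => ∏ k ∈ Finset.range (K + 1), survGen z (t - ∑ i ∈ Finset.range (k + 1), T i))
    ((measurable_prod_survGen z (K + 1)).comp measurable_prodMk_left)
    fun T => norm_prod_le_one _ fun k _ => norm_survGen_le hz _]
  refine integral_congr_ae (.of_forall fun u => ?_)
  simp only [busyGenTrunc]
  rw [← integral_const_mul]
  refine integral_congr_ae (.of_forall fun T => ?_)
  simp only
  rw [Finset.prod_range_succ', mul_comm]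
  simp only [Finset.sum_range_succ' _ (_ + 1), Finset.sum_range_one, zero_add, consSeq]
  congr 1
  refine Finset.prod_congr rfl fun k _ => ?_
  congr 1
  ring

lemma integral_exp_neg_expMeasure (hr : 0 < r) :
    ∫ u, Real.exp (-u) ∂(expMeasure r) = r / (r + 1) := by
  rw [integral_expMeasure hr]
  have : ∀ u : ℝ, (r * Real.exp (-(r * u))) • Real.exp (-u) = r * Real.exp (-(r + 1) * u) :=
    fun u => by rw [smul_eq_mul, mul_assoc, ← Real.exp_add]; ring_nf
  simp only [this]
  rw [integral_const_mul, integral_exp_mul_Ioi (by linarith), mul_zero, Real.exp_zero,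
    neg_div_neg_eq, mul_one_div]

lemma integrable_exp_neg_expMeasure (hr : 0 < r) :
    Integrable (fun u => Real.exp (-u)) (expMeasure r) := by
  by_contra h
  have := integral_undef h
  rw [integral_exp_neg_expMeasure hr] at this
  exact (by positivity : r / (r + 1) ≠ 0) this

lemma busyGenTrunc_of_neg (hr : 0 < r) (hz : ‖z‖ ≤ 1) (K : ℕ) :
    ∀ {t : ℝ}, t < 0 → busyGenTrunc r z K t = 1 := by
  have := isProbabilityMeasure_expMeasure hr
  induction K with
  | zero => intro t _; simp [busyGenTrunc]
  | succ K ih =>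
    intro t ht
    rw [busyGenTrunc_succ hr hz]
    have : ∫ u, survGen z (t - u) * busyGenTrunc r z K (t - u) ∂(expMeasure r) =
        ∫ _, 1 ∂(expMeasure r) := by
      refine integral_congr_ae ((ae_pos_expMeasure r).mono fun u hu => ?_)
      simp only
      rw [ih (by linarith), survGen_of_neg z (by linarith), one_mul]
    rw [this]
    simp

/-- The renewal equation is a contraction in a weighted supremum norm. -/
lemma norm_busyGenTrunc_sub_le (hr : 0 < r) (hz : ‖z‖ ≤ 1) (K : ℕ) :
    ∀ t : ℝ, ‖busyGenTrunc r z K t - busyGen r z t‖ ≤ 2 * (r / (r + 1)) ^ K * Real.exp t := by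
  have := isProbabilityMeasure_expMeasure hr
  induction K with
  | zero =>
    intro t
    rcases lt_or_ge t 0 with ht | ht
    · rw [busyGenTrunc_of_neg hr hz _ ht, busyGen_of_neg r z ht]; simp; positivity
    · have h1 := norm_sub_le (busyGenTrunc r z 0 t) (busyGen r z t)
      have h2 := norm_busyGenTrunc_le hr hz 0 t
      have h3 := norm_busyGen_le hr hz t
      have h4 := Real.one_le_exp ht
      simp only [pow_zero, mul_one]
      linarith
  | succ K ih =>
    intro t
    rcases lt_or_ge t 0 with ht | ht
    · rw [busyGenTrunc_of_neg hr hz _ ht, busyGen_of_neg r z ht]; simp; positivity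
    have hm : Measurable fun u => t - u := by fun_prop
    have hi : ∀ f : ℝ → ℂ, Measurable f → (∀ t, ‖f t‖ ≤ 1) →
        Integrable (fun u => survGen z (t - u) * f (t - u)) (expMeasure r) := fun f hf hf1 => by
      refine .of_bound (((measurable_survGen z).comp hm).mul (hf.comp hm)).aestronglyMeasurable 1
        (.of_forall fun u => ?_)
      simp only [norm_mul]
      exact mul_le_one₀ (norm_survGen_le hz _) (norm_nonneg _) (hf1 _)
    rw [busyGenTrunc_succ hr hz, ← integral_survGen_mul_busyGen hr z ht,
      ← integral_sub (hi _ (measurable_busyGenTrunc hr K) (norm_busyGenTrunc_le hr hz K))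
        (hi _ (measurable_busyGen r z) (norm_busyGen_le hr hz))]
    -- The weight splits as `exp (t - u) = exp t * exp (-u)`; the mean of `exp (-u)` is the
    -- contraction factor `r / (r + 1)`.
    refine (norm_integral_le_of_norm_le
      (g := fun u => 2 * (r / (r + 1)) ^ K * Real.exp t * Real.exp (-u))
      ((integrable_exp_neg_expMeasure hr).const_mul _) (.of_forall fun u => ?_)).trans_eq ?_
    · rw [← mul_sub, norm_mul, mul_assoc, ← Real.exp_add, ← sub_eq_add_neg]
      calc _ ≤ 1 * _ := mul_le_mul_of_nonneg_right (norm_survGen_le hz _) (norm_nonneg _)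
        _ ≤ _ := by rw [one_mul]; exact ih _
    · rw [integral_const_mul, integral_exp_neg_expMeasure hr, pow_succ]
      ring

lemma tendsto_busyGenTrunc (hr : 0 < r) (hz : ‖z‖ ≤ 1) (t : ℝ) :
    Tendsto (fun K => busyGenTrunc r z K t) atTop (𝓝 (busyGen r z t)) := by
  rw [tendsto_iff_norm_sub_tendsto_zero]
  have h0 : 0 ≤ r / (r + 1) := by positivity
  have h1 : r / (r + 1) < 1 := (div_lt_one (by linarith)).2 (by linarith)
  have := ((tendsto_pow_atTop_nhds_zero_of_lt_one h0 h1).const_mul 2).mul_const (Real.exp t)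
  rw [mul_zero, zero_mul] at this
  exact squeeze_zero (fun _ => norm_nonneg _)
    (fun K => norm_busyGenTrunc_sub_le hr hz K t) this

lemma measurable_arrival_jobStream_prod (S : ℕ → ℝ) (j : ℕ) :
    Measurable fun p : ℕ × (ℕ → ℝ) => (jobStream p.1 p.2 S).arrival j :=
  measurable_from_prod_countable_right fun N => measurable_arrival_jobStream N j

open Classical in
/-- Truncation to the first `n` jobs of the power of `z` whose exponent is the number of active
jobs. -/
noncomputable def activeGen (z : ℂ) (t : ℝ) (n : ℕ) (J : JobStream) : ℂ :=
  ∏ j ∈ Finset.range n, if J.arrival j ≤ t ∧ t < J.arrival j + J.size j then z else 1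

lemma norm_activeGen_le (hz : ‖z‖ ≤ 1) (t : ℝ) (n : ℕ) (J : JobStream) :
    ‖activeGen z t n J‖ ≤ 1 :=
  norm_prod_le_one _ fun j _ => by split_ifs <;> simp [hz]

lemma measurable_activeGen (z : ℂ) (t : ℝ) (n : ℕ) :
    Measurable fun p : ℕ × (ℕ → ℝ) × (ℕ → ℝ) => activeGen z t n (jobStream p.1 p.2.1 p.2.2) := by
  refine Finset.measurable_prod _ fun j _ => Measurable.ite ?_ measurable_const measurable_const
  have ha : Measurable fun p : ℕ × (ℕ → ℝ) × (ℕ → ℝ) =>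
      (jobStream p.1 p.2.1 p.2.2).arrival j :=
    (measurable_arrival_jobStream_prod 0 j).comp
      (measurable_fst.prodMk (measurable_fst.comp measurable_snd))
  have hs : Measurable fun p : ℕ × (ℕ → ℝ) × (ℕ → ℝ) => (jobStream p.1 p.2.1 p.2.2).size j :=
    (measurable_pi_apply j).comp (measurable_snd.comp measurable_snd)
  exact (measurableSet_le ha measurable_const).inter
    (measurableSet_lt measurable_const (ha.add hs))

-- With the arrival times frozen, independence of the sizes factorises the integral. Each of the `N`
-- initial jobs has age `t`; the other `K` give the truncated queue.
open Classical in
lemma integral_activeGen (hr : 0 < r) (hz : ‖z‖ ≤ 1) (t : ℝ) (N K : ℕ) :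
    ∫ p, activeGen z t (N + K) (jobStream N p.1 p.2) ∂((expSeqMeasure r).prod (expSeqMeasure 1)) =
      survGen z t ^ N * busyGenTrunc r z K t := by
  have := isProbabilityMeasure_expMeasure hr
  have := isProbabilityMeasure_expMeasure one_pos
  have hi : Integrable (fun p : (ℕ → ℝ) × (ℕ → ℝ) => activeGen z t (N + K) (jobStream N p.1 p.2))
      ((expSeqMeasure r).prod (expSeqMeasure 1)) :=
    .of_bound ((measurable_activeGen z t _).comp measurable_prodMk_left).aestronglyMeasurable 1
      (.of_forall fun p => norm_activeGen_le hz _ _ _)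
  rw [integral_prod _ hi, busyGenTrunc, ← integral_const_mul]
  refine integral_congr_ae (.of_forall fun T => ?_)
  simp only [activeGen]
  have := integral_prod_infinitePi (expMeasure 1) (N + K)
    (f := fun j s => if (jobStream N T 0).arrival j ≤ t ∧ t < (jobStream N T 0).arrival j + s
      then z else 1)
    (fun j => Measurable.ite ((MeasurableSet.const _).inter
      (measurableSet_lt measurable_const (measurable_const.add measurable_id))) measurable_const measurable_const)
    (fun j s => by split_ifs <;> simp [hz])
  refine Eq.trans this ?_
  simp only [integral_size_expMeasure]
  rw [Finset.prod_range_add]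
  congr 1
  · rw [Finset.prod_congr rfl (g := fun _ => survGen z t) fun j hj => ?_]
    · simp
    · simp [jobStream, Finset.mem_range.1 hj]
  · refine Finset.prod_congr rfl fun k _ => ?_
    simp [jobStream]

end Multiserver

/-! ### Law of the occupancy and stationarity -/

namespace Multiserver

/-- On the unit circle the generating function is the characteristic function of the law pushed to
`ℝ`. -/
lemma ext_of_integral_pow {μ ν : Measure ℕ} [IsFiniteMeasure μ] [IsFiniteMeasure ν]
    (h : ∀ z : ℂ, ‖z‖ = 1 → ∫ n, z ^ n ∂μ = ∫ n, z ^ n ∂ν) : μ = ν := by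
  have hcast : MeasurableEmbedding (Nat.cast : ℕ → ℝ) :=
    ⟨Nat.cast_injective, .of_discrete, fun s _ => (s.to_countable.image _).measurableSet⟩
  have hchar : ∀ (ρ : Measure ℕ) (s : ℝ), charFun (ρ.map (Nat.cast : ℕ → ℝ)) s =
      ∫ n, Complex.exp (s * Complex.I) ^ n ∂ρ := fun ρ s => by
    rw [charFun_apply_real, hcast.integral_map]
    refine integral_congr_ae (.of_forall fun n => ?_)
    simp only
    rw [← Complex.exp_nat_mul]
    congr 1
    push_cast
    ring
  have hmap : μ.map (Nat.cast : ℕ → ℝ) = ν.map Nat.cast := by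
    refine Measure.ext_of_charFun (funext fun s => ?_)
    rw [hchar, hchar]
    exact h _ (Complex.norm_exp_ofReal_mul_I s)
  rw [← hcast.comap_map μ, hmap, hcast.comap_map]

lemma integral_pow_poissonMeasure (r : ℝ≥0) (w : ℂ) :
    ∫ n, w ^ n ∂(poissonMeasure r) = Complex.exp (r * (w - 1)) := by
  rw [integral_poissonMeasure]
  have h : HasSum (fun n : ℕ => ((r : ℂ) * w) ^ n / (n.factorial : ℂ)) (Complex.exp (r * w)) := by
    rw [Complex.exp_eq_exp_ℂ]
    exact NormedSpace.expSeries_div_hasSum_exp _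
  have h2 := (h.mul_left (Complex.exp (-r))).tsum_eq
  rw [← Complex.exp_add] at h2
  rw [show (r : ℂ) * (w - 1) = -r + r * w by ring, ← h2]
  refine tsum_congr fun n => ?_
  rw [Complex.real_smul]
  push_cast
  ring

section Stochastic

variable {Ω : Type*} [MeasurableSpace Ω] {P : Measure Ω} {lam : ℝ≥0}
  {N₀ : Ω → ℕ} {T S : ℕ → Ω → ℝ} {z : ℂ}

lemma hasLaw_input [IsProbabilityMeasure P] (hin : IsPoissonExpInput P lam N₀ T S) :
    HasLaw (fun ω => (N₀ ω, (fun i => T i ω), fun j => S j ω))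
      ((P.map N₀).prod ((expSeqMeasure lam).prod (expSeqMeasure 1))) P := by
  have hT : HasLaw (fun ω i => T i ω) (expSeqMeasure lam) P :=
    ⟨(measurable_pi_iff.2 hin.measurable_interarrival).aemeasurable, by
      rw [hin.indep_interarrival.map_fun_eq_infinitePi_map hin.measurable_interarrival]
      simp only [(hin.law_interarrival _).map_eq]⟩
  have hS : HasLaw (fun ω j => S j ω) (expSeqMeasure 1) P :=
    ⟨(measurable_pi_iff.2 hin.measurable_size).aemeasurable, by
      rw [hin.indep_size.map_fun_eq_infinitePi_map hin.measurable_size]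
      simp only [(hin.law_size _).map_eq]⟩
  have hN : HasLaw N₀ (P.map N₀) P := ⟨hin.measurable_init.aemeasurable, rfl⟩
  have h1 := IndepFun.hasLaw_prod hT hS hin.indep_interarrival_size
  exact IndepFun.hasLaw_prod hN h1 hin.indep_init

lemma tendsto_activeGen {J : JobStream} (hJ : IsRegular J) (z : ℂ) (t : ℝ) :
    Tendsto (fun n => activeGen z t n J) atTop (𝓝 (z ^ (active J t).ncard)) := by
  classical
  obtain ⟨M, hM⟩ := (finite_active hJ t).bddAbove
  refine tendsto_const_nhds.congr' ?_
  filter_upwards [eventually_gt_atTop M] with n hn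
  have hsub : active J t = (Finset.range n).filter (· ∈ active J t) := by
    ext j
    simpa using fun hj => (hM hj).trans_lt hn
  conv_lhs => rw [hsub, ncard_coe_finset]
  rw [← Finset.prod_const, Finset.prod_filter]
  refine Finset.prod_congr rfl fun j _ => if_congr Iff.rfl rfl rfl

/-- The generating function of the number of jobs in the `M/M/∞` queue: the initial jobs and the
later arrivals contribute independently. -/
lemma integral_pow_ncard_active [IsProbabilityMeasure P] (hlam : 0 < lam)
    (hin : IsPoissonExpInput P lam N₀ T S) (hz : ‖z‖ ≤ 1) (t : ℝ) :
    ∫ ω, z ^ (active (input N₀ T S ω) t).ncard ∂P =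
      (∫ n, survGen z t ^ n ∂(P.map N₀)) * busyGen lam z t := by
  have hl : (0 : ℝ) < lam := hlam
  have := isProbabilityMeasure_expMeasure hl
  have := isProbabilityMeasure_expMeasure one_pos
  have := Measure.isProbabilityMeasure_map (μ := P) hin.measurable_init.aemeasurable
  have hlaw := hasLaw_input hin
  have hmeas : ∀ n, AEStronglyMeasurable (fun ω => activeGen z t n (input N₀ T S ω)) P := fun n =>
    ((measurable_activeGen z t n).comp_aemeasurable hlaw.aemeasurable).aestronglyMeasurable
  have h1 : Tendsto (fun n => ∫ ω, activeGen z t n (input N₀ T S ω) ∂P) atTop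
      (𝓝 (∫ ω, z ^ (active (input N₀ T S ω) t).ncard ∂P)) := by
    refine tendsto_integral_of_dominated_convergence (fun _ => 1) hmeas (integrable_const _)
      (fun n => .of_forall fun ω => norm_activeGen_le hz _ _ _) ?_
    filter_upwards [ae_isErgodic_input hlam hin] with ω hω
    exact tendsto_activeGen hω.toIsRegular z t
  set G : ℕ → ℕ → ℂ := fun n N => ∫ p, activeGen z t n (jobStream N p.1 p.2)
    ∂((expSeqMeasure lam).prod (expSeqMeasure 1)) with hG
  have h2 : ∀ n, ∫ ω, activeGen z t n (input N₀ T S ω) ∂P = ∫ N, G n N ∂(P.map N₀) := fun n => by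
    have := hlaw.integral_comp (measurable_activeGen z t n).aestronglyMeasurable
    refine this.trans (integral_prod _ ?_)
    exact .of_bound (measurable_activeGen z t n).aestronglyMeasurable 1
      (.of_forall fun p => norm_activeGen_le hz _ _ _)
  have h3 : Tendsto (fun n => ∫ N, G n N ∂(P.map N₀)) atTop
      (𝓝 (∫ N, survGen z t ^ N * busyGen lam z t ∂(P.map N₀))) := by
    refine tendsto_integral_of_dominated_convergence (fun _ => 1)
      (fun n => AEStronglyMeasurable.of_discrete) (integrable_const _)
      (fun n => .of_forall fun N => ?_) (.of_forall fun N => ?_)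
    · refine (norm_integral_le_of_norm_le_const (C := 1)
        (.of_forall fun p => norm_activeGen_le hz _ _ _)).trans (by simp)
    -- For fixed `N`, truncating at `n = N + K` jobs retains all initial jobs and `K` later ones.
    · rw [← tendsto_add_atTop_iff_nat N]
      refine ((tendsto_busyGenTrunc hl hz t).const_mul _).congr fun K => ?_
      rw [← integral_activeGen hl hz t N K, hG, add_comm N K]
  simp only [h2] at h1
  rw [tendsto_nhds_unique h1 h3, integral_mul_const]

lemma aemeasurable_ncard_active (hlam : 0 < lam) (hin : IsPoissonExpInput P lam N₀ T S) (t : ℝ) :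
    AEMeasurable (fun ω => (active (input N₀ T S ω) t).ncard) P := by
  have hcount : AEMeasurable (fun ω => ((active (input N₀ T S ω) t).ncard : ℝ)) P := by
    classical
    have ha : ∀ j, Measurable fun ω => (input N₀ T S ω).arrival j := fun j =>
      (measurable_arrival_jobStream_prod 0 j).comp
        (hin.measurable_init.prodMk (measurable_pi_iff.2 hin.measurable_interarrival))
    have hm : ∀ n, AEMeasurable (fun ω => ∑ j ∈ Finset.range n,
        if j ∈ active (input N₀ T S ω) t then (1 : ℝ) else 0) P := fun n =>
      (Finset.measurable_sum _ fun j _ => Measurable.ite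
        ((measurableSet_le (ha j) measurable_const).inter
          (measurableSet_lt measurable_const ((ha j).add (hin.measurable_size j))))
        measurable_const measurable_const).aemeasurable
    refine aemeasurable_of_tendsto_metrizable_ae atTop hm ?_
    filter_upwards [ae_isErgodic_input hlam hin] with ω hω
    obtain ⟨M, hM⟩ := (finite_active hω.toIsRegular t).bddAbove
    refine tendsto_const_nhds.congr' ?_
    filter_upwards [eventually_gt_atTop M] with n hn
    exact ncard_eq_sum_ite fun j hj => by simpa using (hM hj).trans_lt hn
  have := (Nat.measurable_floor (R := ℝ)).comp_aemeasurable hcount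
  simpa [Function.comp_def] using this

/-- The number of jobs in the `M/M/∞` queue is stationary iff it starts with the Poisson law. -/
lemma hasLaw_ncard_active_iff [IsProbabilityMeasure P] (hlam : 0 < lam)
    (hin : IsPoissonExpInput P lam N₀ T S) :
    (∀ t : ℝ, 0 ≤ t → HasLaw (fun ω => (active (input N₀ T S ω) t).ncard) (P.map N₀) P) ↔
      HasLaw N₀ (poissonMeasure lam) P := by
  have hl : (0 : ℝ) < lam := hlam
  have := Measure.isProbabilityMeasure_map (μ := P) hin.measurable_init.aemeasurable
  constructor
  · intro h
    refine ⟨hin.measurable_init.aemeasurable, ext_of_integral_pow fun z hz => ?_⟩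
    have hexp : Tendsto (fun t => ((Real.exp (-t) : ℝ) : ℂ)) atTop (𝓝 0) := by
      exact_mod_cast (Complex.continuous_ofReal.tendsto 0).comp
        Real.tendsto_exp_neg_atTop_nhds_zero
    have hpgf : ∀ᶠ t : ℝ in atTop, (∫ n, survGen z t ^ n ∂(P.map N₀)) * busyGen lam z t =
        ∫ n, z ^ n ∂(P.map N₀) := by
      filter_upwards [eventually_ge_atTop 0] with t ht
      rw [← integral_pow_ncard_active hlam hin hz.le t, ← (h t ht).integral_comp
        (AEStronglyMeasurable.of_discrete (f := fun n : ℕ => z ^ n))]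
      rfl
    have hbusy : Tendsto (fun t => busyGen lam z t) atTop
        (𝓝 (Complex.exp (-(lam * (1 - z) * (1 - 0))))) := by
      have := (((hexp.const_sub 1).const_mul ((lam : ℂ) * (1 - z))).neg).cexp
      refine this.congr' ?_
      filter_upwards [eventually_ge_atTop 0] with t ht
      rw [busyGen_of_nonneg _ _ ht]
    have hsurv : Tendsto (fun t => survGen z t) atTop (𝓝 1) := by
      have := (hexp.const_mul (1 - z)).const_sub 1
      rw [mul_zero, sub_zero] at this
      refine this.congr' ?_
      filter_upwards [eventually_ge_atTop 0] with t ht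
      rw [survGen_of_nonneg _ ht]
    have hint : Tendsto (fun t => ∫ n, survGen z t ^ n ∂(P.map N₀)) atTop
        (𝓝 (∫ n, (1 : ℂ) ^ n ∂(P.map N₀))) := by
      refine tendsto_integral_filter_of_dominated_convergence (fun _ => 1)
        (.of_forall fun t => AEStronglyMeasurable.of_discrete)
        (.of_forall fun t => .of_forall fun n => ?_) (integrable_const _)
        (.of_forall fun n => hsurv.pow n)
      rw [norm_pow]
      exact pow_le_one₀ (norm_nonneg _) (norm_survGen_le hz.le _)
    -- Stationarity makes the product constant in `t`, while its first factor tends to `1` and its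
    -- second to the Poisson generating function.
    have := tendsto_nhds_unique ((hint.mul hbusy).congr' hpgf) tendsto_const_nhds
    rw [integral_pow_poissonMeasure, ← this]
    simp only [one_pow, integral_const, probReal_univ, one_smul, one_mul, sub_zero, mul_one]
    congr 1
    ring
  · intro h t ht
    refine ⟨aemeasurable_ncard_active hlam hin t, ?_⟩
    have := Measure.isProbabilityMeasure_map (aemeasurable_ncard_active hlam hin t)
    refine ext_of_integral_pow fun z hz => ?_
    rw [integral_map (aemeasurable_ncard_active hlam hin t) AEStronglyMeasurable.of_discrete,
      integral_pow_ncard_active hlam hin hz.le t, h.map_eq, integral_pow_poissonMeasure,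
      integral_pow_poissonMeasure, survGen_of_nonneg z ht, busyGen_of_nonneg _ z ht,
      ← Complex.exp_add]
    congr 1
    push_cast
    ring

end Stochastic

end Multiserver

/-! ### Almost sure statements for policies and the competitive bound -/

namespace Multiserver

section Stochastic

variable {Ω : Type*} [MeasurableSpace Ω] {P : Measure Ω} {lam : ℝ≥0}
  {N₀ : Ω → ℕ} {T S : ℕ → Ω → ℝ} {x y : Ω → Schedule} {α : ℝ}

lemma exists_policy_serving_all (hlam : 0 < lam) (hin : IsPoissonExpInput P lam N₀ T S) :
    ∃ x, IsPolicy P (input N₀ T S) x ∧ UsesRates P (input N₀ T S) (fun i => i) x :=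
  ⟨fun ω => active (input N₀ T S ω),
    (ae_isErgodic_input hlam hin).mono fun _ h => isFeasible_active h.toIsRegular,
    (ae_isErgodic_input hlam hin).mono fun _ h t _ => numServers_active h.toIsRegular t⟩

lemma ae_numJobs_eq (hlam : 0 < lam) (hin : IsPoissonExpInput P lam N₀ T S)
    (hx : IsPolicy P (input N₀ T S) x) (hr : UsesRates P (input N₀ T S) (fun i => i) x) :
    ∀ᵐ ω ∂P, ∀ t, numJobs (input N₀ T S ω) (x ω) t = (active (input N₀ T S ω) t).ncard := by
  filter_upwards [ae_isErgodic_input hlam hin, hx, hr] with ω h1 h2 h3 t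
  rw [numJobs, present_eq_active h1.toIsRegular h2 h3]

lemma ae_tendsto_avgOccupancy (hlam : 0 < lam) (hin : IsPoissonExpInput P lam N₀ T S)
    (hx : IsPolicy P (input N₀ T S) x) (hr : UsesRates P (input N₀ T S) (fun i => i) x) :
    ∀ᵐ ω ∂P, Tendsto (avgOccupancy (input N₀ T S ω) (x ω)) atTop (𝓝 (lam : ℝ)) := by
  filter_upwards [ae_isErgodic_input hlam hin, ae_numJobs_eq hlam hin hx hr] with ω h1 h2
  refine (tendsto_avg_active h1).congr fun t => ?_
  simp only [avgOccupancy, h2]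

lemma ae_tendsto_switchingRate [IsProbabilityMeasure P] (hlam : 0 < lam)
    (hin : IsPoissonExpInput P lam N₀ T S) (hx : IsPolicy P (input N₀ T S) x) (hr : UsesRates P (input N₀ T S) (fun i => i) x) :
    ∀ᵐ ω ∂P, Tendsto (switchingRate (x ω)) atTop (𝓝 (2 * (lam : ℝ))) := by
  filter_upwards [ae_isErgodic_input hlam hin, ae_hasSimpleEvents_input hin,
    ae_numJobs_eq hlam hin hx hr, hr] with ω h1 h2 h3 h4
  exact tendsto_switchingCost_active h1 h2 fun t ht => (h4 t ht).trans (h3 t)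

lemma hasCost_serving_all [IsProbabilityMeasure P] (hlam : 0 < lam)
    (hin : IsPoissonExpInput P lam N₀ T S) (hx : IsPolicy P (input N₀ T S) x) (hr : UsesRates P (input N₀ T S) (fun i => i) x) :
    HasCost P (input N₀ T S) α x ((lam : ℝ) * (1 + 2 * α)) := by
  filter_upwards [ae_tendsto_avgOccupancy hlam hin hx hr,
    ae_tendsto_switchingRate hlam hin hx hr] with ω h1 h2
  rw [show (lam : ℝ) * (1 + 2 * α) = lam + α * (2 * lam) by ring]
  exact h1.add (h2.const_mul α)

lemma ae_eventually_lt_avgOccupancy (hlam : 0 < lam) (hin : IsPoissonExpInput P lam N₀ T S)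
    (hy : IsPolicy P (input N₀ T S) y) :
    ∀ᵐ ω ∂P, ∀ c : ℝ, c < lam → ∀ᶠ t in atTop, c < avgOccupancy (input N₀ T S ω) (y ω) t := by
  filter_upwards [ae_isErgodic_input hlam hin, hy] with ω h1 h2 c hc
  filter_upwards [(tendsto_avg_active h1).eventually_const_lt hc, eventually_ge_atTop 0]
    with t h3 ht
  refine h3.trans_le (mul_le_mul_of_nonneg_left ?_ (by positivity))
  exact integral_ncard_active_le h1.toIsRegular h2 ht

/-- Two almost sure events on a probability space share an outcome; there the occupancy alone
eventually exceeds every `d < lam`, and switching only adds cost. -/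
lemma le_cost [IsProbabilityMeasure P] (hlam : 0 < lam) (hα : 0 < α)
    (hin : IsPoissonExpInput P lam N₀ T S) (hy : IsPolicy P (input N₀ T S) y) {C : ℝ} (hC : HasCost P (input N₀ T S) α y C) :
    (lam : ℝ) ≤ C := by
  obtain ⟨ω, h1, h2⟩ := ((ae_eventually_lt_avgOccupancy hlam hin hy).and hC).exists
  refine le_of_forall_lt fun c hc => ?_
  obtain ⟨d, hcd, hd⟩ := exists_between hc
  refine hcd.trans_le (ge_of_tendsto h2 ?_)
  filter_upwards [h1 d hd, eventually_ge_atTop 0] with t ht ht0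
  have : 0 ≤ α * switchingRate (y ω) t :=
    mul_nonneg hα.le (div_nonneg (switchingCost_nonneg _ _) ht0)
  linarith

end Stochastic

end Multiserver

theorem mainTheorem8 {Ω : Type*} [MeasurableSpace Ω] (P : Measure Ω) [IsProbabilityMeasure P]
    (lam : ℝ≥0) (hlam : 0 < lam) (α : ℝ) (hα : 0 < α)
    (N₀ : Ω → ℕ) (T S : ℕ → Ω → ℝ)
    (hin : Multiserver.IsPoissonExpInput P lam N₀ T S) :
    -- the policy `μ i = i` exists
    (∃ x : Ω → Multiserver.Schedule,
      Multiserver.IsPolicy P (Multiserver.input N₀ T S) x ∧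
      Multiserver.UsesRates P (Multiserver.input N₀ T S) (fun i => i) x) ∧
    -- its stationary distribution, its cost and its competitiveness
    (∀ x : Ω → Multiserver.Schedule,
      Multiserver.IsPolicy P (Multiserver.input N₀ T S) x →
      Multiserver.UsesRates P (Multiserver.input N₀ T S) (fun i => i) x →
        ((∀ t : ℝ, 0 ≤ t →
            HasLaw (fun ω => Multiserver.numJobs (Multiserver.input N₀ T S ω) (x ω) t)
              (P.map N₀) P) ↔
          HasLaw N₀ (poissonMeasure lam) P) ∧
        (∀ᵐ ω ∂P, Tendsto (Multiserver.avgOccupancy (Multiserver.input N₀ T S ω) (x ω))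
          atTop (𝓝 (lam : ℝ))) ∧
        (∀ᵐ ω ∂P, Tendsto (Multiserver.switchingRate (x ω)) atTop (𝓝 (2 * (lam : ℝ)))) ∧
        Multiserver.HasCost P (Multiserver.input N₀ T S) α x ((lam : ℝ) * (1 + 2 * α)) ∧
        Multiserver.IsCompetitive P (Multiserver.input N₀ T S) α (1 + 2 * α) x) ∧
    -- every policy has long-run average occupancy at least `lam`
    (∀ y : Ω → Multiserver.Schedule,
      Multiserver.IsPolicy P (Multiserver.input N₀ T S) y →
        ∀ᵐ ω ∂P, ∀ c : ℝ, c < lam → ∀ᶠ t in atTop,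
          c < Multiserver.avgOccupancy (Multiserver.input N₀ T S ω) (y ω) t) := by
  refine ⟨Multiserver.exists_policy_serving_all hlam hin, fun x hx hr => ⟨?_, ?_, ?_, ?_, ?_⟩,
    fun y hy => Multiserver.ae_eventually_lt_avgOccupancy hlam hin hy⟩
  · rw [← Multiserver.hasLaw_ncard_active_iff hlam hin]
    refine forall₂_congr fun t _ => hasLaw_congr ?_
    exact (Multiserver.ae_numJobs_eq hlam hin hx hr).mono fun ω h => h t
  · exact Multiserver.ae_tendsto_avgOccupancy hlam hin hx hr
  · exact Multiserver.ae_tendsto_switchingRate hlam hin hx hr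
  · exact Multiserver.hasCost_serving_all hlam hin hx hr
  · refine ⟨_, Multiserver.hasCost_serving_all hlam hin hx hr, fun y C hy hC => ?_⟩
    rw [mul_comm]
    exact mul_le_mul_of_nonneg_left (Multiserver.le_cost hlam hα hin hy hC) (by positivity)
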